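/- Let $F$ be an infinite field of characteristic different from $2$, let $E=E_0\oplus E_1$ be the unital Grassmann (exterior) algebra of an $F$-vector space of countably infinite dimension with its even and odd parts, and let $R=M_{1,1}(E)$ be the algebra of matrices $\begin{pmatrix} a&b\\c&d\end{pmatrix}$ with $a,d\in E_0$, $b,c\in E_1$. Let $W\subset R$ be the subspace of the matrices of supertrace $a-d=0$, and let $I_w\subset F\langle X\rangle$, $X=\{x_1,x_2,\dots\}$, be the ideal of weak polynomial identities of $(R,W)$, that is of the polynomials that vanish whenever elements of $W$ are substituted for the variables. Let $B$ be the unital subalgebra of $F\langle X\rangle$ generated by all left-normed commutators $[x_{i_1},\dots,x_{i_l}]$ of length $l\ge 2$. For a vector $(n_i)=(n_1,\dots,n_k)$ of integers $n_i\ge 0$ let $B^{(n_i)}$ be the multihomogeneous component of $B$ of multidegree $(n_i)$, and put $B^{(n_i)}(I_w)=B^{(n_i)}/(B^{(n_i)}\cap I_w)$. A c-array is a two-rowed array $S=\begin{bmatrix}a_1&\cdots&a_m\\ b_1&\cdots&b_m\end{bmatrix}$ of positive integers ($m\ge 0$) with $a_i>b_i$ for all $i$ and with columns $(a_i,b_i)\le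 (a_{i+1},b_{i+1})$ in the lexicographic order. It has content $(n_i)$ if each $i$ occurs exactly $n_i$ times among its entries. It is normal if no integer occurs more than twice among its entries and there are no indices $r<s<t$ with $b_r\le b_s\le b_t$. Let $N^{(n_i)}$ be the set of normal c-arrays of content $(n_i)$, and let $f_S=[x_{a_1},x_{b_1}]\cdots[x_{a_m},x_{b_m}]$. Theorem 7.1. Let $l$ and $q$ be the numbers of indices $i$ with $n_i=1$ and with $n_i=2$, respectively, and let $n=\sum n_i$. Then $B^{(n_i)}(I_w)=0$ if and only if one of the following holds: (i) $n$ is odd; (ii) $n$ is even and $n_i>2$ for some $i$; (iii) $n$ is even, $n_i\le 2$ for all $i$, $l=0$ and $q$ is odd. Otherwise $l=2s$ is even, the classes of the $f_S$ with $S\in N^{(n_i)}$ form a linear basis of $B^{(n_i)}(I_w)$ (indexed by $N^{(n_i)}$), and the dimension of this space is $\binom{2s-1}{s}$, where $\binom{-1}{0}=1$. -/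

import Mathlib

noncomputable section

namespace WeakPI

/-! ### The superalgebra `M_{1,1}(E)` -/

/-- The (unital) Grassmann algebra `E` of an `F`-vector space of countable dimension. -/
abbrev Grassmann (F : Type*) [Field F] : Type _ := ExteriorAlgebra F (ℕ →₀ F)

/-- The homogeneous components `E_0` and `E_1` of `E = E_0 ⊕ E_1`: the span of the products of an
even, respectively odd, number of vectors. (The exterior algebra is the Clifford algebra of the
zero quadratic form.) -/
def grassmannPart (F : Type*) [Field F] (i : ZMod 2) : Submodule F (Grassmann F) :=
  CliffordAlgebra.evenOdd (0 : QuadraticForm F (ℕ →₀ F)) i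

theorem grassmannPart_mul_mem {F : Type*} [Field F] {i j : ZMod 2} {a b : Grassmann F}
    (ha : a ∈ grassmannPart F i) (hb : b ∈ grassmannPart F j) :
    a * b ∈ grassmannPart F (i + j) :=
  CliffordAlgebra.evenOdd_mul_le _ i j (Submodule.mul_mem_mul ha hb)

theorem grassmannPart_algebraMap_mem {F : Type*} [Field F] (r : F) :
    algebraMap F (Grassmann F) r ∈ grassmannPart F 0 := by
  rw [Algebra.algebraMap_eq_smul_one]
  exact Submodule.smul_mem _ _ (Submodule.one_le.mp (CliffordAlgebra.one_le_evenOdd_zero _))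

/-- `M_{1,1}(E)`: the `2 × 2` matrices over `E` with diagonal entries in `E_0` and off-diagonal
entries in `E_1`. -/
def M11 (F : Type*) [Field F] : Subalgebra F (Matrix (Fin 2) (Fin 2) (Grassmann F)) where
  carrier := {A | A 0 0 ∈ grassmannPart F 0 ∧ A 1 1 ∈ grassmannPart F 0 ∧
    A 0 1 ∈ grassmannPart F 1 ∧ A 1 0 ∈ grassmannPart F 1}
  mul_mem' := by
    rintro A B ⟨a1, a2, a3, a4⟩ ⟨b1, b2, b3, b4⟩
    have h11 : (1 : ZMod 2) + 1 = 0 := by decide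
    simp only [Set.mem_ofPred_eq, Matrix.mul_apply, Fin.sum_univ_two]
    refine ⟨add_mem ?_ ?_, add_mem ?_ ?_, add_mem ?_ ?_, add_mem ?_ ?_⟩
    · simpa using grassmannPart_mul_mem a1 b1
    · simpa only [h11] using grassmannPart_mul_mem a3 b4
    · simpa only [h11] using grassmannPart_mul_mem a4 b3
    · simpa using grassmannPart_mul_mem a2 b2
    · simpa using grassmannPart_mul_mem a1 b3
    · simpa using grassmannPart_mul_mem a3 b2
    · simpa using grassmannPart_mul_mem a4 b1
    · simpa using grassmannPart_mul_mem a2 b4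
  add_mem' := by
    rintro A B ⟨a1, a2, a3, a4⟩ ⟨b1, b2, b3, b4⟩
    exact ⟨add_mem a1 b1, add_mem a2 b2, add_mem a3 b3, add_mem a4 b4⟩
  algebraMap_mem' := by
    intro r
    simp [Matrix.algebraMap_matrix_apply, grassmannPart_algebraMap_mem]

/-- The supertrace `str(A) = a - d` of `A = (a b; c d)`. -/
def str (F : Type*) [Field F] : M11 F →ₗ[F] Grassmann F where
  toFun A := A.1 0 0 - A.1 1 1
  map_add' A B := by simp [add_sub_add_comm]
  map_smul' r A := by simp [smul_sub]

/-- The space `W` of the matrices of supertrace zero. -/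
def supertraceZero (F : Type*) [Field F] : Submodule F (M11 F) := LinearMap.ker (str F)

/-! ### Weak identities and proper polynomials

The free associative algebra has the countable set of variables `FreeAlgebra.ι F i`, `i : ℕ`;
the variable `x_{i+1}` is indexed by `i`. -/

/-- The weak polynomial identities of a pair `(R, W)`: the polynomials that vanish whenever elements
of `W` are substituted for the variables. -/
def weakIdentities {F R : Type*} [Field F] [Ring R] [Algebra F R] (W : Submodule F R) :
    Submodule F (FreeAlgebra F ℕ) where
  carrier := {f | ∀ w : ℕ → R, (∀ i, w i ∈ W) → FreeAlgebra.lift F w f = 0}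
  add_mem' hf hg w hw := by rw [map_add, hf w hw, hg w hw, add_zero]
  zero_mem' w _ := map_zero _
  smul_mem' r f hf w hw := by rw [map_smul, hf w hw, smul_zero]

/-- `I_w`, the weak identities of the pair `(M_{1,1}(E), W)`. -/
def Iw (F : Type*) [Field F] : Submodule F (FreeAlgebra F ℕ) := weakIdentities (supertraceZero F)

/-- The left-normed commutator `[x_i, x_j, x_{w_1}, …, x_{w_r}]`, of length `r + 2`. -/
def commutator (F : Type*) [Field F] (i j : ℕ) (w : List ℕ) : FreeAlgebra F ℕ :=
  w.foldl (fun u a => ⁅u, FreeAlgebra.ι F a⁆) ⁅FreeAlgebra.ι F i, FreeAlgebra.ι F j⁆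

/-- The algebra `B` of proper polynomials, generated by the commutators of length at least `2`. -/
def properPolynomials (F : Type*) [Field F] : Subalgebra F (FreeAlgebra F ℕ) :=
  Algebra.adjoin F {f | ∃ (i j : ℕ) (w : List ℕ), f = commutator F i j w}

/-- The multiset of entries of a list as a vector `(n_i)`: `i` occurs `n_i` times. -/
def wordContent (w : List ℕ) : ℕ →₀ ℕ := Multiset.toFinsupp (w : Multiset ℕ)

/-- The multihomogeneous component of multidegree `(n_i)` of the free algebra. -/
def multihomogeneous (F : Type*) [Field F] (n : ℕ →₀ ℕ) : Submodule F (FreeAlgebra F ℕ) :=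
  Submodule.span F {f | ∃ w : List ℕ, wordContent w = n ∧ f = (w.map (FreeAlgebra.ι F)).prod}

/-- The component `B^{(n_i)}` of the algebra of proper polynomials. -/
def properComponent (F : Type*) [Field F] (n : ℕ →₀ ℕ) : Submodule F (FreeAlgebra F ℕ) :=
  Subalgebra.toSubmodule (properPolynomials F) ⊓ multihomogeneous F n

/-- `B^{(n_i)}(I_w) = B^{(n_i)} / (B^{(n_i)} ∩ I_w)`. -/
abbrev QuotComponent (F : Type*) [Field F] (n : ℕ →₀ ℕ) : Type _ :=
  properComponent F n ⧸ (Iw F).submoduleOf (properComponent F n)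

/-! ### Arrays of commutators

A two-rowed array is the list of its columns `(a_i, b_i)`. -/

/-- The content of an array. -/
def content (S : List (ℕ × ℕ)) : ℕ →₀ ℕ := wordContent (S.flatMap fun c => [c.1, c.2])

/-- `f_S = [x_{a_1}, x_{b_1}] ⋯ [x_{a_m}, x_{b_m}]`. -/
def arrayPolynomial (F : Type*) [Field F] (S : List (ℕ × ℕ)) : FreeAlgebra F ℕ :=
  (S.map fun c => ⁅FreeAlgebra.ι F c.1, FreeAlgebra.ι F c.2⁆).prod

/-- A c-array: `a_i > b_i` in every column, and the columns increase weakly in the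
lexicographic order. -/
structure IsCArray (S : List (ℕ × ℕ)) : Prop where
  gt : ∀ c ∈ S, c.2 < c.1
  sorted : S.Pairwise fun c d => c.1 < d.1 ∨ (c.1 = d.1 ∧ c.2 ≤ d.2)

/-- A normal c-array: no integer occurs more than twice, and there are no indices `r < s < t` with
`b_r ≤ b_s ≤ b_t`. -/
structure IsNormal (S : List (ℕ × ℕ)) : Prop extends IsCArray S where
  le_two : ∀ i, content S i ≤ 2
  no_increasing : ¬ ∃ r s t : Fin S.length, r < s ∧ s < t ∧
    (S.get r).2 ≤ (S.get s).2 ∧ (S.get s).2 ≤ (S.get t).2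

/-- `N^{(n_i)}`, the set of normal c-arrays of content `(n_i)`. -/
def normalArrays (n : ℕ →₀ ℕ) : Set (List (ℕ × ℕ)) := {S | IsNormal S ∧ content S = n}

theorem wordContent_append (v w : List ℕ) :
    wordContent (v ++ w) = wordContent v + wordContent w := by
  simp [wordContent, ← Multiset.coe_add]

theorem multihomogeneous_mul_mem {F : Type*} [Field F] {m n : ℕ →₀ ℕ} {f g : FreeAlgebra F ℕ}
    (hf : f ∈ multihomogeneous F m) (hg : g ∈ multihomogeneous F n) :
    f * g ∈ multihomogeneous F (m + n) := by
  have h := Submodule.mul_mem_mul hf hg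
  rw [multihomogeneous, multihomogeneous, Submodule.span_mul_span] at h
  refine Submodule.span_mono ?_ h
  rintro _ ⟨_, ⟨v, rfl, rfl⟩, _, ⟨w, rfl, rfl⟩, rfl⟩
  exact ⟨v ++ w, wordContent_append v w, by simp⟩

theorem arrayPolynomial_mem_multihomogeneous {F : Type*} [Field F] (S : List (ℕ × ℕ)) :
    arrayPolynomial F S ∈ multihomogeneous F (content S) := by
  induction S with
  | nil => exact Submodule.subset_span ⟨[], rfl, rfl⟩
  | cons c S ih =>
    have h : content (c :: S) = wordContent [c.1, c.2] + content S := by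
      rw [content, List.flatMap_cons, wordContent_append, content]
    have h' : wordContent [c.1, c.2] = wordContent [c.2, c.1] := by
      unfold wordContent
      congr 1
      exact Multiset.coe_eq_coe.mpr (List.Perm.swap _ _ _)
    rw [h, arrayPolynomial, List.map_cons, List.prod_cons]
    refine multihomogeneous_mul_mem ?_ ih
    rw [Ring.lie_def]
    exact sub_mem (Submodule.subset_span ⟨[c.1, c.2], rfl, by simp⟩)
      (Submodule.subset_span ⟨[c.2, c.1], h'.symm, by simp⟩)

theorem arrayPolynomial_mem {F : Type*} [Field F] (S : List (ℕ × ℕ)) :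
    arrayPolynomial F S ∈ properComponent F (content S) := by
  refine ⟨?_, arrayPolynomial_mem_multihomogeneous S⟩
  refine Subalgebra.list_prod_mem (properPolynomials F) fun f hf => ?_
  obtain ⟨c, _, rfl⟩ := List.mem_map.mp hf
  exact Algebra.subset_adjoin ⟨c.1, c.2, [], rfl⟩

/-- The class of `f_S` in `B^{(n_i)}(I_w)`, for `S` a normal c-array of content `(n_i)`. -/
def arrayClass (F : Type*) [Field F] (n : ℕ →₀ ℕ) (S : normalArrays n) : QuotComponent F n :=
  Submodule.Quotient.mk ⟨arrayPolynomial F S.1, by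
    have h := arrayPolynomial_mem (F := F) S.1
    rwa [S.2.2] at h⟩

/-- The number of indices `i` with `n_i = c`, for `c ≠ 0`. -/
def occurrences (n : ℕ →₀ ℕ) (c : ℕ) : ℕ := (n.support.filter fun i => n i = c).card

/-- The cases in which the component vanishes. -/
def IsExceptional (n : ℕ →₀ ℕ) : Prop :=
  Odd n.degree ∨
  (Even n.degree ∧ ∃ i, 2 < n i) ∨
  (Even n.degree ∧ (∀ i, n i ≤ 2) ∧ occurrences n 1 = 0 ∧ Odd (occurrences n 2))

end WeakPI

end

/-! ### Odd substitutions in the Grassmann algebra and the generic pairing. -/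

namespace WeakPI

open ExteriorAlgebra

/-! ### Supercommutativity of the Grassmann algebra -/

section Super

variable {F : Type*} [Field F]

/-! A matrix of supertrace zero is an even scalar plus an off-diagonal odd part. Hence the
commutator of two such matrices is the scalar matrix of the even element `b_i c_j - b_j c_i`, which
is central, and longer commutators vanish (`evalMatrix_lie`, `evalMatrix_commutator_cons`).
Arbitrary odd elements may be substituted for free generators, so a single evaluation, with `y_i =
upper F i` and `z_i = lower F i` off the diagonal, decides whether a proper polynomial is a weak
identity (`mem_Iw_iff`). The component of multidegree `n` thereby becomes the span `skewSpan` of the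
products of `y_i z_j - y_j z_i` of content `n` (`exists_embedding`).

Upper bound. The pairing `y_i z_j` changes sign when two lower indices are exchanged, so the `3 × 3`
permanents of skew pairings vanish (`skew_permanent`). They rewrite every product containing a chain
`b_r ≤ b_s ≤ b_t` through products of smaller weight `∑ a_i b_i`, so the normal arrays span
(`skewProd_mem_span_normalArrays`). A recursive enumeration, estimated by ballot numbers, shows that
there are at most `binom(2s-1, s)` of them (`ncard_normalArrays_le`); if no index has multiplicity
one, there is at most one, and none when `q` is odd.

Lower bound. The substitution of `-y_j z_i` for `y_i z_j` fixes the skew pairings, and every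
monomial plus its image lies in `skewSpan` (`exchange_sum_mem`). For an `s`-element set `B` of
indices of multiplicity one, take the monomial with `y_i` for `i` in `B`, `z_i` for the other such
indices, and `y_i z_i` for those of multiplicity two. Complementary sets give the same sum up to
sign, and the remaining `binom(2s-1, s)` sums are independent (`exists_linearIndependent_skewSpan`).

The two bounds agree, so the spanning normal arrays form a basis and their number is the dimension.
-/

theorem commute_of_mem_even {a : Grassmann F} (ha : a ∈ grassmannPart F 0) (x : Grassmann F) :
    Commute a x := by
  induction a, ha using CliffordAlgebra.even_induction with
  | algebraMap r => exact Algebra.commutes r x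
  | add a b _ _ iha ihb => exact iha.add_left ihb
  | ι_mul_ι_mul u v a _ ih =>
    refine Commute.mul_left ?_ ih
    clear ih
    change Commute (ι F u * ι F v) x
    induction x using ExteriorAlgebra.induction with
    | algebraMap r => exact (Algebra.commutes r _).symm
    | ι w =>
      have h1 := eq_neg_of_add_eq_zero_left (ι_add_mul_swap (R := F) v w)
      have h2 := eq_neg_of_add_eq_zero_left (ι_add_mul_swap (R := F) u w)
      change _ * _ = _ * _
      rw [mul_assoc, h1, mul_neg, ← mul_assoc, h2, neg_mul, neg_neg, mul_assoc]
    | mul a b iha ihb => exact iha.mul_right ihb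
    | add a b iha ihb => exact iha.add_right ihb

theorem ι_mul_of_mem_odd (u : ℕ →₀ F) {b : Grassmann F} (hb : b ∈ grassmannPart F 1) :
    ι F u * b = -(b * ι F u) := by
  induction b, hb using CliffordAlgebra.odd_induction with
  | ι v => exact eq_neg_of_add_eq_zero_left (ι_add_mul_swap (R := F) u v)
  | add a b _ _ iha ihb => rw [mul_add, iha, ihb, add_mul, neg_add]
  | ι_mul_ι_mul v w b _ ih =>
    have h := (commute_of_mem_even (F := F)
      (CliffordAlgebra.ι_mul_ι_mem_evenOdd_zero _ v w) (ι F u)).eq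
    rw [← mul_assoc, ← h, mul_assoc, ih, mul_neg]
    simp only [mul_assoc]

theorem mul_eq_neg_mul_of_mem_odd {a b : Grassmann F} (ha : a ∈ grassmannPart F 1)
    (hb : b ∈ grassmannPart F 1) : a * b = -(b * a) := by
  induction a, ha using CliffordAlgebra.odd_induction with
  | ι v => exact ι_mul_of_mem_odd v hb
  | add a a' _ _ iha iha' => rw [add_mul, iha, iha', mul_add, neg_add]
  | ι_mul_ι_mul v w a _ ih =>
    have h := (commute_of_mem_even (F := F)
      (CliffordAlgebra.ι_mul_ι_mem_evenOdd_zero _ v w) b).eq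
    rw [mul_assoc, ih, mul_neg, ← mul_assoc, h, mul_assoc]

theorem eq_zero_of_eq_neg_self (hF : ringChar F ≠ 2) {M : Type*} [AddCommGroup M] [Module F M]
    {x : M} (h : x = -x) : x = 0 := by
  have h2 : (2 : F) • x = 0 := by
    rw [two_smul]
    nth_rewrite 2 [h]
    exact add_neg_cancel x
  exact (smul_eq_zero.mp h2).resolve_left (Ring.two_ne_zero hF)

theorem mul_self_of_mem_odd (hF : ringChar F ≠ 2) {a : Grassmann F}
    (ha : a ∈ grassmannPart F 1) : a * a = 0 :=
  eq_zero_of_eq_neg_self hF (mul_eq_neg_mul_of_mem_odd ha ha)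

/-- Arbitrary odd elements can be substituted for the generators of the Grassmann algebra. -/
theorem exists_algHom_of_odd (hF : ringChar F ≠ 2) (b c : ℕ → Grassmann F)
    (hb : ∀ i, b i ∈ grassmannPart F 1) (hc : ∀ i, c i ∈ grassmannPart F 1) :
    ∃ ψ : Grassmann F →ₐ[F] Grassmann F, ∀ i,
      ψ (ι F (Finsupp.single (2 * i) 1)) = b i ∧
      ψ (ι F (Finsupp.single (2 * i + 1) 1)) = c i := by
  -- Basis vectors of even index carry the `b i`, those of odd index the `c i`. The map extends to
  -- the exterior algebra because odd elements have square zero.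
  let g : (ℕ →₀ F) →ₗ[F] Grassmann F :=
    Finsupp.linearCombination F fun k => if k % 2 = 0 then b (k / 2) else c (k / 2)
  have hg : ∀ v, g v ∈ grassmannPart F 1 := fun v => by
    refine Submodule.sum_mem _ fun k _ => Submodule.smul_mem _ _ ?_
    dsimp only
    split_ifs
    exacts [hb _, hc _]
  refine ⟨lift F ⟨g, fun v => mul_self_of_mem_odd hF (hg v)⟩, fun i => ?_⟩
  constructor
  · rw [lift_ι_apply]
    simp [g]
  · rw [lift_ι_apply]
    simp [g, Nat.add_mod, show (2 * i + 1) / 2 = i by omega]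

end Super

/-! ### The generic pair of odd elements -/

section Generic

variable (F : Type*) [Field F]

/-- The odd generator in the upper right corner of the `i`-th generic matrix. -/
noncomputable def upper (i : ℕ) : Grassmann F := ι F (Finsupp.single (2 * i) 1)

/-- The odd generator in the lower left corner of the `i`-th generic matrix. -/
noncomputable def lower (i : ℕ) : Grassmann F := ι F (Finsupp.single (2 * i + 1) 1)

variable {F}

theorem upper_mem (i : ℕ) : upper F i ∈ grassmannPart F 1 := CliffordAlgebra.ι_mem_evenOdd_one _ _

theorem lower_mem (i : ℕ) : lower F i ∈ grassmannPart F 1 := CliffordAlgebra.ι_mem_evenOdd_one _ _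

variable (F)

/-- The even product `y_i z_j` of two generators, as an element of the centre. -/
noncomputable def genericPairing (i j : ℕ) : Subalgebra.center F (Grassmann F) :=
  ⟨upper F i * lower F j, Subalgebra.mem_center_iff.mpr fun b =>
    ((commute_of_mem_even
      (by simpa [show (1 : ZMod 2) + 1 = 0 by decide] using
        grassmannPart_mul_mem (upper_mem (F := F) i) (lower_mem j)) b).eq).symm⟩

/-- The two lower generators trade places among anticommuting factors. Straightening and the
exchange lemmas use no other property of the pairing, so they are stated for any `A` with this
relation over a commutative ring; the centre is such a ring. -/
theorem genericPairing_exchange (i j k l : ℕ) :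
    genericPairing F i j * genericPairing F k l
      = -(genericPairing F i l * genericPairing F k j) := by
  apply Subtype.ext
  change upper F i * lower F j * (upper F k * lower F l)
    = -(upper F i * lower F l * (upper F k * lower F j))
  have h1 := mul_eq_neg_mul_of_mem_odd (lower_mem (F := F) j) (upper_mem k)
  have h2 := mul_eq_neg_mul_of_mem_odd (lower_mem (F := F) l) (upper_mem k)
  have h3 := mul_eq_neg_mul_of_mem_odd (lower_mem (F := F) j) (lower_mem l)
  calc upper F i * lower F j * (upper F k * lower F l)
      = upper F i * (lower F j * upper F k) * lower F l := by noncomm_ring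
    _ = -(upper F i * upper F k * (lower F j * lower F l)) := by rw [h1]; noncomm_ring
    _ = upper F i * upper F k * (lower F l * lower F j) := by rw [h3]; noncomm_ring
    _ = -(upper F i * -(upper F k * lower F l) * lower F j) := by noncomm_ring
    _ = -(upper F i * (lower F l * upper F k) * lower F j) := by rw [h2]
    _ = _ := by noncomm_ring

end Generic

end WeakPI

/-! ### Relations between skew pairings, and straightening to normal arrays. -/

namespace WeakPI

/-! ### Content of arrays -/

theorem content_nil : content [] = 0 := by simp [content, wordContent]

theorem content_cons (c : ℕ × ℕ) (S : List (ℕ × ℕ)) :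
    content (c :: S) = Finsupp.single c.1 1 + Finsupp.single c.2 1 + content S := by
  have h : wordContent [c.1, c.2] = Finsupp.single c.1 1 + Finsupp.single c.2 1 := by
    have : ((([c.1, c.2] : List ℕ)) : Multiset ℕ) = {c.1} + {c.2} := rfl
    rw [wordContent, this, map_add, Multiset.toFinsupp_singleton, Multiset.toFinsupp_singleton]
  rw [content, List.flatMap_cons, wordContent_append, h, content]

theorem content_append (S T : List (ℕ × ℕ)) : content (S ++ T) = content S + content T := by
  rw [content, List.flatMap_append, wordContent_append, content, content]

theorem content_perm {S T : List (ℕ × ℕ)} (h : S.Perm T) : content S = content T := by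
  unfold content wordContent
  exact congrArg _ (Multiset.coe_eq_coe.mpr (h.flatMap_right _))

theorem degree_content (S : List (ℕ × ℕ)) : (content S).degree = 2 * S.length := by
  induction S with
  | nil => simp [content_nil]
  | cons c S ih =>
    rw [content_cons, map_add, map_add, ih, Finsupp.degree_single, Finsupp.degree_single,
      List.length_cons]
    ring

/-! ### Products of skew pairings -/

section Pairing

variable {C : Type*} [CommRing C] (A : ℕ → ℕ → C)

/-- The skew-symmetrization of a pairing. -/
def skew (i j : ℕ) : C := A i j - A j i

/-- The symmetrization of a pairing. -/
def symm (i j : ℕ) : C := A i j + A j i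

/-- The product of the skew pairings of the columns of an array. -/
def skewProd (S : List (ℕ × ℕ)) : C := (S.map fun c => skew A c.1 c.2).prod

theorem skew_self (i : ℕ) : skew A i i = 0 := sub_self _

theorem skew_swap (i j : ℕ) : skew A j i = -skew A i j := (neg_sub _ _).symm

theorem skewProd_nil : skewProd A [] = 1 := rfl

theorem skewProd_cons (c : ℕ × ℕ) (S : List (ℕ × ℕ)) :
    skewProd A (c :: S) = skew A c.1 c.2 * skewProd A S := by
  rw [skewProd, List.map_cons, List.prod_cons, skewProd]

theorem skewProd_perm {S T : List (ℕ × ℕ)} (h : S.Perm T) : skewProd A S = skewProd A T :=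
  (h.map _).prod_eq

variable {A} (hA : ∀ i j k l, A i j * A k l = -(A i l * A k j))

include hA

/-- The second fundamental relation: a `3 × 3` permanent of skew pairings vanishes. -/
theorem skew_permanent (a₁ a₂ a₃ b₁ b₂ b₃ : ℕ) :
    skew A a₁ b₁ * (skew A a₂ b₂ * skew A a₃ b₃) + skew A a₁ b₂ * (skew A a₂ b₁ * skew A a₃ b₃)
      + skew A a₁ b₁ * (skew A a₂ b₃ * skew A a₃ b₂) + skew A a₁ b₃ * (skew A a₂ b₂ * skew A a₃ b₁)
      + skew A a₁ b₂ * (skew A a₂ b₃ * skew A a₃ b₁)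
      + skew A a₁ b₃ * (skew A a₂ b₁ * skew A a₃ b₂) = 0 := by
  -- After symmetrizing in `u` and `v`, products of two terms of the same type (`A x u` or `A u x`)
  -- cancel by `hA`, and only mixed ones remain. In the full permanent each mixed product meets a
  -- third factor, whose type agrees with one of its two, so everything cancels.
  have key : ∀ x y u v : ℕ, skew A x u * skew A y v + skew A x v * skew A y u
      = -(A x u * A v y + A u x * A y v + A x v * A u y + A v x * A y u) := by
    intro x y u v
    unfold skew
    linear_combination hA x u y v + hA u x v y
  have k1 := key a₁ a₂ b₁ b₂
  have k2 := key a₁ a₂ b₁ b₃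
  have k3 := key a₁ a₂ b₂ b₃
  have hL : skew A a₁ b₁ * (skew A a₂ b₂ * skew A a₃ b₃) + skew A a₁ b₂ * (skew A a₂ b₁ * skew A a₃ b₃)
      + skew A a₁ b₁ * (skew A a₂ b₃ * skew A a₃ b₂) + skew A a₁ b₃ * (skew A a₂ b₂ * skew A a₃ b₁)
      + skew A a₁ b₂ * (skew A a₂ b₃ * skew A a₃ b₁)
      + skew A a₁ b₃ * (skew A a₂ b₁ * skew A a₃ b₂)
      = -(A a₁ b₁ * A b₂ a₂ + A b₁ a₁ * A a₂ b₂ + A a₁ b₂ * A b₁ a₂ + A b₂ a₁ * A a₂ b₁)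
          * skew A a₃ b₃
        - (A a₁ b₁ * A b₃ a₂ + A b₁ a₁ * A a₂ b₃ + A a₁ b₃ * A b₁ a₂ + A b₃ a₁ * A a₂ b₁)
          * skew A a₃ b₂
        - (A a₁ b₂ * A b₃ a₂ + A b₂ a₁ * A a₂ b₃ + A a₁ b₃ * A b₂ a₂ + A b₃ a₁ * A a₂ b₂)
          * skew A a₃ b₁ := by
    linear_combination k1 * skew A a₃ b₃ + k2 * skew A a₃ b₂ + k3 * skew A a₃ b₁
  rw [hL]
  unfold skew
  linear_combination
    -(A b₂ a₂) * hA a₁ b₁ a₃ b₃ - (A b₁ a₁) * hA a₂ b₂ a₃ b₃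
    - (A b₁ a₂) * hA a₁ b₂ a₃ b₃ - (A b₂ a₁) * hA a₂ b₁ a₃ b₃
    - (A b₃ a₂) * hA a₁ b₁ a₃ b₂ - (A b₃ a₁) * hA a₂ b₁ a₃ b₂
    + (A a₁ b₁) * hA b₂ a₂ b₃ a₃ + (A a₂ b₂) * hA b₁ a₁ b₃ a₃
    + (A a₁ b₂) * hA b₁ a₂ b₃ a₃ + (A a₂ b₁) * hA b₂ a₁ b₃ a₃
    + (A a₁ b₃) * hA b₁ a₂ b₂ a₃ + (A a₂ b₃) * hA b₁ a₁ b₂ a₃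

/-- Symmetric pairings can be eliminated two at a time in favour of skew ones. -/
theorem symm_mul_symm (i j k l : ℕ) :
    symm A i j * symm A k l = skew A i k * skew A j l + skew A i l * skew A j k := by
  unfold symm skew
  linear_combination -hA i l j k + hA i k l j + hA k i j l + hA i l k j + hA l i j k - hA k i l j

end Pairing

end WeakPI

namespace WeakPI

/-! ### Straightening -/

/-- The sum of the products of the entries of the columns. -/
def weight (S : List (ℕ × ℕ)) : ℕ := (S.map fun c => c.1 * c.2).sum

theorem weight_cons (c : ℕ × ℕ) (S : List (ℕ × ℕ)) : weight (c :: S) = c.1 * c.2 + weight S := by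
  rw [weight, List.map_cons, List.sum_cons, weight]

theorem weight_perm {S T : List (ℕ × ℕ)} (h : S.Perm T) : weight S = weight T :=
  (h.map _).sum_eq

/-- Three columns of an array forming a weakly increasing chain. -/
theorem exists_chain_of_not_isNormal {S : List (ℕ × ℕ)} (hS : IsCArray S)
    (h2 : ∀ i, content S i ≤ 2) (hn : ¬ IsNormal S) :
    ∃ c d e : ℕ × ℕ, ∃ T, S.Perm (c :: d :: e :: T) ∧
      c.1 ≤ d.1 ∧ d.1 ≤ e.1 ∧ c.2 ≤ d.2 ∧ d.2 ≤ e.2 := by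
  have hex : ∃ r s t : Fin S.length, r < s ∧ s < t ∧
      (S.get r).2 ≤ (S.get s).2 ∧ (S.get s).2 ≤ (S.get t).2 := by
    by_contra h
    exact hn ⟨hS, h2, h⟩
  obtain ⟨r, s, t, hrs, hst, h12, h23⟩ := hex
  have hle : ∀ i j : Fin S.length, i < j → (S.get i).1 ≤ (S.get j).1 := fun i j hij => by
    have := List.pairwise_iff_get.mp hS.sorted i j hij
    omega
  have hsub : [S.get r, S.get s, S.get t].Sublist S := by
    rw [List.sublist_iff_exists_fin_orderEmbedding_get_eq]
    refine ⟨OrderEmbedding.ofStrictMono ![r, s, t] ?_, fun i => ?_⟩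
    · intro i j hij
      fin_cases i <;> fin_cases j <;> simp_all [lt_trans hrs hst]
    · fin_cases i <;> rfl
  obtain ⟨T, hT⟩ := hsub.exists_perm_append
  exact ⟨_, _, _, T, hT, hle _ _ hrs, hle _ _ hst, h12, h23⟩

/-- Every array without columns `(i, i)` can be rearranged into a c-array. -/
theorem exists_isCArray {C : Type*} [CommRing C] (A : ℕ → ℕ → C) (S : List (ℕ × ℕ)) :
    skewProd A S = 0 ∨ ∃ T, IsCArray T ∧ content T = content S ∧ weight T = weight S ∧
      (skewProd A S = skewProd A T ∨ skewProd A S = -skewProd A T) := by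
  have h1 : skewProd A S = 0 ∨ ∃ T, (∀ c ∈ T, c.2 < c.1) ∧ content T = content S ∧
      weight T = weight S ∧ (skewProd A S = skewProd A T ∨ skewProd A S = -skewProd A T) := by
    induction S with
    | nil => exact .inr ⟨[], by simp, rfl, rfl, .inl rfl⟩
    | cons c S ih =>
      rw [skewProd_cons]
      rcases ih with ih | ⟨T, hT, hc, hw, hs⟩
      · exact .inl (by rw [ih, mul_zero])
      rcases lt_trichotomy c.1 c.2 with h | h | h
      · refine .inr ⟨(c.2, c.1) :: T, ?_, ?_, ?_, ?_⟩
        · rintro d hd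
          rcases List.mem_cons.mp hd with rfl | hd
          exacts [h, hT d hd]
        · rw [content_cons, content_cons, hc, add_comm (Finsupp.single c.2 1)]
        · rw [weight_cons, weight_cons, hw, mul_comm c.2]
        · rw [skewProd_cons, skew_swap A c.1 c.2]
          rcases hs with hs | hs <;> rw [hs]
          · exact .inr (by ring)
          · exact .inl (by ring)
      · exact .inl (by rw [h, skew_self, zero_mul])
      · refine .inr ⟨c :: T, ?_, ?_, ?_, ?_⟩
        · rintro d hd
          rcases List.mem_cons.mp hd with rfl | hd
          exacts [h, hT d hd]
        · rw [content_cons, content_cons, hc]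
        · rw [weight_cons, weight_cons, hw]
        · rw [skewProd_cons]
          rcases hs with hs | hs <;> rw [hs]
          · exact .inl rfl
          · exact .inr (by ring)
  rcases h1 with h | ⟨T, hT, hc, hw, hs⟩
  · exact .inl h
  let r : ℕ × ℕ → ℕ × ℕ → Prop := fun c d => toLex c ≤ toLex d
  have hp : (T.insertionSort r).Perm T := T.perm_insertionSort r
  refine .inr ⟨T.insertionSort r, ⟨fun c hc => hT c (hp.mem_iff.mp hc), ?_⟩, ?_, ?_, ?_⟩
  · have : Std.Total r := ⟨fun c d => le_total (toLex c) (toLex d)⟩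
    have : IsTrans (ℕ × ℕ) r := ⟨fun c d e h h' => le_trans (α := ℕ ×ₗ ℕ) h h'⟩
    refine (T.pairwise_insertionSort r).imp fun {c d} h => ?_
    exact Prod.Lex.toLex_le_toLex.mp h
  · rw [content_perm hp, hc]
  · rw [weight_perm hp, hw]
  · rwa [skewProd_perm A hp]

section

variable {F : Type*} [Field F] {C : Type*} [CommRing C] [Algebra F C] {A : ℕ → ℕ → C}

theorem mem_of_smul_mem_of_ne_zero {V : Submodule F C} {k : F} (hk : k ≠ 0) {x : C}
    (h : k • x ∈ V) : x ∈ V := by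
  simpa [smul_smul, inv_mul_cancel₀ hk] using V.smul_mem k⁻¹ h

/-- The rearrangement inequalities behind the straightening of a chain of three columns. -/
theorem mem_of_chain (hF : ringChar F ≠ 2) (hA : ∀ i j k l, A i j * A k l = -(A i l * A k j))
    {V : Submodule F C} {a₁ a₂ a₃ b₁ b₂ b₃ : ℕ} {T : List (ℕ × ℕ)}
    (ha₁ : a₁ ≤ a₂) (ha₂ : a₂ ≤ a₃) (ha : a₁ < a₃) (hb₁ : b₁ ≤ b₂) (hb₂ : b₂ ≤ b₃) (hb : b₁ < b₃)
    (hV : ∀ S, content S = content ((a₁, b₁) :: (a₂, b₂) :: (a₃, b₃) :: T) →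
      weight S < weight ((a₁, b₁) :: (a₂, b₂) :: (a₃, b₃) :: T) → skewProd A S ∈ V) :
    skewProd A ((a₁, b₁) :: (a₂, b₂) :: (a₃, b₃) :: T) ∈ V := by
  have h2 : (2 : F) ≠ 0 := Ring.two_ne_zero hF
  let f : ℕ → ℕ → ℕ → C := fun x y z => skewProd A ((a₁, x) :: (a₂, y) :: (a₃, z) :: T)
  have hf : ∀ x y z, f x y z = skew A a₁ x * (skew A a₂ y * skew A a₃ z) * skewProd A T :=
    fun x y z => by simp only [f, skewProd_cons]; ring
  -- The six arrangements of the lower entries under fixed upper entries are the terms of the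
  -- vanishing permanent. The increasing one has the largest weight, by rearrangement.
  have hsum : f b₁ b₂ b₃ + f b₂ b₁ b₃ + f b₁ b₃ b₂ + f b₃ b₂ b₁ + f b₂ b₃ b₁ + f b₃ b₁ b₂ = 0 := by
    simp only [hf]
    linear_combination (skewProd A T) * skew_permanent hA a₁ a₂ a₃ b₁ b₂ b₃
  have hlow : ∀ x y z, ({x} + {y} + {z} : Multiset ℕ) = {b₁} + {b₂} + {b₃} →
      a₁ * x + a₂ * y + a₃ * z < a₁ * b₁ + a₂ * b₂ + a₃ * b₃ → f x y z ∈ V := by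
    intro x y z hm hw
    refine hV _ ?_ ?_
    · have := congrArg Multiset.toFinsupp hm
      simp only [map_add, Multiset.toFinsupp_singleton] at this
      simp only [content_cons]
      rw [show ∀ p q r s t u v : ℕ →₀ ℕ, p + s + (q + t + (r + u + v)) = p + q + r + v + (s + t + u)
        by intros; abel, this]
      abel
    · simp only [weight_cons]
      omega
  -- In terms of the gaps `p, q` of the upper and `u, v` of the lower entries, the loss of weight is
  -- a sum of products of a gap above with a gap below; the rearrangement is strictly lower when one
  -- of these is positive.
  obtain ⟨p, hp⟩ := Nat.exists_eq_add_of_le ha₁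
  obtain ⟨q, hq⟩ := Nat.exists_eq_add_of_le ha₂
  obtain ⟨u, hu⟩ := Nat.exists_eq_add_of_le hb₁
  obtain ⟨v, hv⟩ := Nat.exists_eq_add_of_le hb₂
  have m12 : 0 < p → 0 < u → f b₂ b₁ b₃ ∈ V := fun h h' => by
    refine hlow _ _ _ (by abel) ?_
    rw [hq, hp, hv, hu]
    nlinarith [Nat.mul_pos h h']
  have m23 : 0 < q → 0 < v → f b₁ b₃ b₂ ∈ V := fun h h' => by
    refine hlow _ _ _ (by abel) ?_
    rw [hq, hp, hv, hu]
    nlinarith [Nat.mul_pos h h']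
  have m13 : f b₃ b₂ b₁ ∈ V := by
    refine hlow _ _ _ (by abel) ?_
    have : 0 < (p + q) * (u + v) := Nat.mul_pos (by omega) (by omega)
    rw [hq, hp, hv, hu]
    nlinarith
  have m231 : 0 < u * (p + q) + v * q → f b₂ b₃ b₁ ∈ V := fun h => by
    refine hlow _ _ _ (by abel) ?_
    rw [hq, hp, hv, hu]
    nlinarith
  have m312 : 0 < u * p + v * (p + q) → f b₃ b₁ b₂ ∈ V := fun h => by
    refine hlow _ _ _ (by abel) ?_
    rw [hq, hp, hv, hu]
    nlinarith
  -- Arrangements whose weight does not drop coincide with the original one because of equal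
  -- entries. Its total coefficient is then 2 or 4, which is invertible.
  have e12 : p = 0 → ∀ x y z, f x y z = f y x z := by
    rintro rfl x y z
    rw [hf, hf, show a₂ = a₁ by omega]
    ring
  have e23 : q = 0 → ∀ x y z, f x y z = f x z y := by
    rintro rfl x y z
    rw [hf, hf, show a₃ = a₂ by omega]
    ring
  have two : ∀ {x y : C}, x + x + y = 0 → y ∈ V → x ∈ V := fun {x y} h hy => by
    refine mem_of_smul_mem_of_ne_zero h2 ?_
    rw [two_smul, eq_neg_of_add_eq_zero_left h]
    exact V.neg_mem hy
  have hpq : 0 < p + q := by omega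
  have huv : 0 < u + v := by omega
  change f b₁ b₂ b₃ ∈ V
  rcases Nat.eq_zero_or_pos u with hu0 | hu0
  · have hv0 : 0 < v := by omega
    have m312' := m312 (Nat.add_pos_right _ (Nat.mul_pos hv0 hpq))
    obtain rfl : b₂ = b₁ := by omega
    rcases Nat.eq_zero_or_pos q with hq0 | hq0
    -- Here `a₂ = a₃` and `b₁ = b₂`: four of the six terms equal the target, so `two` is applied
    -- twice.
    · rw [e23 hq0 b₂ b₃ b₂] at hsum
      refine two (y := -(f b₂ b₂ b₃ + f b₂ b₂ b₃)) (by ring)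
        (neg_mem (two (y := f b₃ b₂ b₂ + f b₃ b₂ b₂) ?_ (add_mem m13 m312')))
      linear_combination hsum
    · refine two (y := f b₂ b₃ b₂ + f b₃ b₂ b₂ + f b₂ b₃ b₂ + f b₃ b₂ b₂) ?_
        (add_mem (add_mem (add_mem (m23 hq0 hv0) m13) (m231 ?_)) m312')
      · linear_combination hsum
      · exact Nat.add_pos_right _ (Nat.mul_pos hv0 hq0)
  · have m231' := m231 (Nat.add_pos_left (Nat.mul_pos hu0 hpq) _)
    rcases Nat.eq_zero_or_pos v with hv0 | hv0
    · obtain rfl : b₃ = b₂ := by omega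
      rcases Nat.eq_zero_or_pos p with hp0 | hp0
      · rw [e12 hp0 b₃ b₁ b₃] at hsum
        refine two (y := -(f b₁ b₃ b₃ + f b₁ b₃ b₃)) (by ring)
          (neg_mem (two (y := f b₃ b₃ b₁ + f b₃ b₃ b₁) ?_ (add_mem m13 m231')))
        linear_combination hsum
      · refine two (y := f b₃ b₁ b₃ + f b₃ b₃ b₁ + f b₃ b₃ b₁ + f b₃ b₁ b₃) ?_
          (add_mem (add_mem (add_mem (m12 hp0 hu0) m13) m231') (m312 ?_))
        · linear_combination hsum
        · exact Nat.add_pos_left (Nat.mul_pos hu0 hp0) _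
    · have m312' := m312 (Nat.add_pos_right _ (Nat.mul_pos hv0 hpq))
      rcases Nat.eq_zero_or_pos p with hp0 | hp0
      · rw [e12 hp0 b₂ b₁ b₃] at hsum
        refine two (y := f b₁ b₃ b₂ + f b₃ b₂ b₁ + f b₂ b₃ b₁ + f b₃ b₁ b₂) ?_
          (add_mem (add_mem (add_mem (m23 (by omega) hv0) m13) m231') m312')
        linear_combination hsum
      · rcases Nat.eq_zero_or_pos q with hq0 | hq0
        · rw [e23 hq0 b₁ b₃ b₂] at hsum
          refine two (y := f b₂ b₁ b₃ + f b₃ b₂ b₁ + f b₂ b₃ b₁ + f b₃ b₁ b₂) ?_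
            (add_mem (add_mem (add_mem (m12 hp0 hu0) m13) m231') m312')
          linear_combination hsum
        · have h : f b₁ b₂ b₃ = -(f b₂ b₁ b₃ + f b₁ b₃ b₂ + f b₃ b₂ b₁ + f b₂ b₃ b₁
              + f b₃ b₁ b₂) := by linear_combination hsum
          rw [h]
          exact V.neg_mem (add_mem (add_mem (add_mem (add_mem (m12 hp0 hu0) (m23 hq0 hv0)) m13)
            m231') m312')

/-- Normal arrays span. -/
theorem skewProd_mem_span_normalArrays (hF : ringChar F ≠ 2)
    (hA : ∀ i j k l, A i j * A k l = -(A i l * A k j)) {n : ℕ →₀ ℕ} (hn : ∀ i, n i ≤ 2)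
    (S : List (ℕ × ℕ)) (hS : content S = n) :
    skewProd A S ∈ Submodule.span F (skewProd A '' normalArrays n) := by
  induction hw : weight S using Nat.strong_induction_on generalizing S with
  | _ w ih =>
    rcases exists_isCArray A S with h | ⟨T, hT, hc, hwT, hs⟩
    · rw [h]; exact zero_mem _
    suffices h : skewProd A T ∈ Submodule.span F (skewProd A '' normalArrays n) by
      rcases hs with hs | hs <;> rw [hs]
      exacts [h, neg_mem h]
    by_cases hN : IsNormal T
    · exact Submodule.subset_span ⟨T, ⟨hN, hc.trans hS⟩, rfl⟩
    obtain ⟨c, d, e, U, hp, h1, h2, h3, h4⟩ :=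
      exists_chain_of_not_isNormal hT (by rwa [hc, hS]) hN
    have hcU : content (c :: d :: e :: U) = n := by rw [← content_perm hp, hc, hS]
    have hwU : weight (c :: d :: e :: U) = w := by rw [← weight_perm hp, hwT, hw]
    rw [skewProd_perm A hp]
    -- No letter occurs three times in the three columns, so neither row of the chain is constant.
    have hcne : ∀ i, (Finsupp.single c.1 1 + Finsupp.single c.2 1 + (Finsupp.single d.1 1 +
        Finsupp.single d.2 1 + (Finsupp.single e.1 1 + Finsupp.single e.2 1)) : ℕ →₀ ℕ) i ≤ 2 := by
      intro i
      refine le_trans ?_ (hn i)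
      rw [← hcU]
      simp only [content_cons, Finsupp.add_apply]
      omega
    refine mem_of_chain hF hA h1 h2 (lt_of_le_of_ne (h1.trans h2) fun h => ?_) h3 h4
      (lt_of_le_of_ne (h3.trans h4) fun h => ?_) fun S' hS' hw' => ?_
    · have := hcne c.1
      rw [show d.1 = c.1 by omega, ← h] at this
      simp only [Finsupp.add_apply, Finsupp.single_eq_same] at this
      omega
    · have := hcne c.2
      rw [show d.2 = c.2 by omega, ← h] at this
      simp only [Finsupp.add_apply, Finsupp.single_eq_same] at this
      omega
    · exact ih _ (hw'.trans_eq hwU) S' (hS'.trans hcU) rfl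

/-- A variable that occurs more than twice makes the product vanish. -/
theorem skewProd_eq_zero_of_two_lt (hF : ringChar F ≠ 2)
    (hA : ∀ i j k l, A i j * A k l = -(A i l * A k j)) (S : List (ℕ × ℕ)) {i : ℕ}
    (hi : 2 < content S i) : skewProd A S = 0 := by
  -- Two factors with `i` in the same position vanish. Expanding three skew factors that contain
  -- `i`, some two have it in the same position.
  have h1 : ∀ j k, A i j * A i k = 0 := fun j k =>
    eq_zero_of_eq_neg_self hF ((hA i j i k).trans (by rw [mul_comm]))
  have h2 : ∀ j k, A j i * A k i = 0 := fun j k => eq_zero_of_eq_neg_self hF (hA j i k i)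
  have h3 : ∀ j k l, skew A i j * skew A i k * skew A i l = 0 := fun j k l => by
    unfold skew
    linear_combination (A i l - A l i) * h1 j k + (A i l - A l i) * h2 j k
      - (A k i) * h1 j l + (A i k) * h2 j l - A j i * h1 k l + (A i j) * h2 k l
  have key : ∀ S : List (ℕ × ℕ), skewProd A S = 0 ∨
      ∃ (l : List ℕ) (x : C), l.length = content S i ∧
        skewProd A S = (l.map fun j => skew A i j).prod * x := by
    intro S
    induction S with
    | nil => exact .inr ⟨[], 1, by simp [content_nil], by simp [skewProd_nil]⟩
    | cons c S ih =>
      rcases ih with ih | ⟨l, x, hl, hx⟩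
      · exact .inl (by rw [skewProd_cons, ih, mul_zero])
      rw [skewProd_cons, content_cons]
      by_cases hc : c.1 = i <;> by_cases hd : c.2 = i
      · exact .inl (by rw [hc, hd, skew_self, zero_mul])
      · refine .inr ⟨c.2 :: l, x, ?_, ?_⟩
        · simp [hc, hd, hl, add_comm]
        · rw [List.map_cons, List.prod_cons, hx, hc, mul_assoc]
      · refine .inr ⟨c.1 :: l, -x, ?_, ?_⟩
        · simp [hc, hd, hl, add_comm]
        · rw [List.map_cons, List.prod_cons, hx, hd, skew_swap A i c.1]
          ring
      · refine .inr ⟨l, skew A c.1 c.2 * x, ?_, ?_⟩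
        · simp [hc, hd, hl]
        · rw [hx]
          ring
  rcases key S with h | ⟨l, x, hl, hx⟩
  · exact h
  match l, hl, hx with
  | [], hl, _ => simp at hl; omega
  | [_], hl, _ => simp at hl; omega
  | [_, _], hl, _ => simp at hl; omega
  | j :: k :: m :: l, _, hx =>
    rw [hx]
    simp only [List.map_cons, List.prod_cons]
    linear_combination (l.map fun j => skew A i j).prod * x * h3 j k m

end

end WeakPI

/-! ### The lower bound: independent elements from exchange-invariant sums. -/

namespace WeakPI

open ExteriorAlgebra

/-! ### Invariants under the exchange of the two families of generators -/

section Invariants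

variable (F : Type*) [Field F] {C : Type*} [CommRing C] [Algebra F C] (A : ℕ → ℕ → C)

/-- The span of the products of skew pairings of content `n`. -/
def skewSpan (n : ℕ →₀ ℕ) : Submodule F C :=
  Submodule.span F {x | ∃ S, content S = n ∧ x = skewProd A S}

variable {F A}

theorem skewProd_mem_skewSpan (S : List (ℕ × ℕ)) : skewProd A S ∈ skewSpan F A (content S) :=
  Submodule.subset_span ⟨S, rfl, rfl⟩

theorem skew_mul_mem {x : C} {n : ℕ →₀ ℕ} (c : ℕ × ℕ) (hx : x ∈ skewSpan F A n) :
    skew A c.1 c.2 * x ∈ skewSpan F A (Finsupp.single c.1 1 + Finsupp.single c.2 1 + n) := by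
  induction hx using Submodule.span_induction with
  | mem x hx =>
    obtain ⟨S, rfl, rfl⟩ := hx
    exact Submodule.subset_span ⟨c :: S, content_cons c S, (skewProd_cons A c S).symm⟩
  | zero => rw [mul_zero]; exact zero_mem _
  | add x y _ _ ihx ihy => rw [mul_add]; exact add_mem ihx ihy
  | smul r x _ ih => rw [mul_smul_comm]; exact Submodule.smul_mem _ r ih

/-- Since `2 * A i j = skew + symm` and `-2 * A j i = skew - symm`, the sum of the two products
contains only terms with an even number of factors `symm`, and these are removed in pairs by
`symm_mul_symm`. The difference contains the odd terms; one further factor `symm` makes them even,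
which is the second half needed for the induction. -/
theorem pairProd_add_mem (hA : ∀ i j k l, A i j * A k l = -(A i l * A k j))
    (T : List (ℕ × ℕ)) :
    (T.map fun c => 2 * A c.1 c.2).prod + (T.map fun c => -2 * A c.2 c.1).prod
        ∈ skewSpan F A (content T) ∧
      ∀ d : ℕ × ℕ, symm A d.1 d.2 *
        ((T.map fun c => 2 * A c.1 c.2).prod - (T.map fun c => -2 * A c.2 c.1).prod)
        ∈ skewSpan F A (Finsupp.single d.1 1 + Finsupp.single d.2 1 + content T) := by
  induction T with
  | nil =>
    refine ⟨?_, fun d => ?_⟩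
    · have := skewProd_mem_skewSpan (F := F) (A := A) []
      rw [skewProd_nil] at this
      exact add_mem this this
    · simp
  | cons c T ih =>
    obtain ⟨h0, h1⟩ := ih
    simp only [List.map_cons, List.prod_cons, content_cons]
    set X := (T.map fun c => 2 * A c.1 c.2).prod
    set Y := (T.map fun c => -2 * A c.2 c.1).prod
    refine ⟨?_, fun d => ?_⟩
    · have e : 2 * A c.1 c.2 * X + -2 * A c.2 c.1 * Y
          = skew A c.1 c.2 * (X + Y) + symm A c.1 c.2 * (X - Y) := by
        unfold skew symm; ring
      rw [e]
      exact add_mem (skew_mul_mem c h0) (h1 c)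
    · have e : symm A d.1 d.2 * (2 * A c.1 c.2 * X - -2 * A c.2 c.1 * Y)
          = skew A c.1 c.2 * (symm A d.1 d.2 * (X - Y))
            + (skew A d.1 c.1 * (skew A d.2 c.2 * (X + Y))
              + skew A d.1 c.2 * (skew A d.2 c.1 * (X + Y))) := by
        have := symm_mul_symm hA d.1 d.2 c.1 c.2
        unfold skew symm at *
        linear_combination (X + Y) * this
      rw [e]
      refine add_mem ?_ (add_mem ?_ ?_)
      · have := skew_mul_mem c (h1 d)
        rwa [add_left_comm] at this
      · have := skew_mul_mem (d.1, c.1) (skew_mul_mem (d.2, c.2) h0)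
        convert this using 1
        dsimp only
        congr 1
        abel
      · have := skew_mul_mem (d.1, c.2) (skew_mul_mem (d.2, c.1) h0)
        convert this using 1
        dsimp only
        congr 1
        abel

theorem prod_map_const_mul (k : C) (f : ℕ × ℕ → C) (T : List (ℕ × ℕ)) :
    (T.map fun c => k * f c).prod = k ^ T.length * (T.map f).prod := by
  induction T with
  | nil => simp
  | cons c T ih =>
    rw [List.map_cons, List.prod_cons, ih, List.map_cons, List.prod_cons, List.length_cons]
    ring

/-- The sum of a monomial and its image under the exchange lies in the span of the products of
skew pairings. -/
theorem exchange_sum_mem (hF : ringChar F ≠ 2)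
    (hA : ∀ i j k l, A i j * A k l = -(A i l * A k j)) (T : List (ℕ × ℕ)) :
    (T.map fun c => A c.1 c.2).prod + (-1) ^ T.length * (T.map fun c => A c.2 c.1).prod
      ∈ skewSpan F A (content T) := by
  have h := (pairProd_add_mem (F := F) hA T).1
  rw [prod_map_const_mul 2 fun c => A c.1 c.2, prod_map_const_mul (-2) fun c => A c.2 c.1] at h
  refine mem_of_smul_mem_of_ne_zero (k := 2 ^ T.length)
    (pow_ne_zero _ (Ring.two_ne_zero hF)) ?_
  convert h using 1
  rw [Algebra.smul_def, map_pow, map_ofNat, neg_pow (2 : C)]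
  ring

end Invariants

/-! ### Nonvanishing monomials -/

section Monomials

variable {F : Type*} [Field F]

/-- The determinant of the coordinates indexed by `l` is an alternating form with value 1 on these
vectors, and alternating forms factor through the exterior algebra. -/
theorem prod_generators_ne_zero {l : List ℕ} (hl : l.Nodup) :
    (l.map fun k => ι F (Finsupp.single k (1 : F))).prod ≠ 0 := by
  let g : (ℕ →₀ F) →ₗ[F] (Fin l.length → F) := LinearMap.pi fun j => Finsupp.lapply (l.get j)
  let f : (ℕ →₀ F) [⋀^Fin l.length]→ₗ[F] F := Matrix.detRowAlternating.compLinearMap g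
  let v : Fin l.length → (ℕ →₀ F) := fun i => Finsupp.single (l.get i) 1
  have hv : (l.map fun k => ι F (Finsupp.single k (1 : F))).prod = ιMulti F l.length v := by
    rw [ιMulti_apply, show (fun i => ι F (v i)) = fun i => (fun k => ι F (Finsupp.single k (1 : F)))
      (l.get i) from rfl]
    congr 1
    exact (List.ofFn_getElem_eq_map l _).symm
  have hf : f v = 1 := by
    have : (fun i => g (v i)) = (1 : Matrix (Fin l.length) (Fin l.length) F) := by
      ext i j
      change Finsupp.single (l.get i) (1 : F) (l.get j) = _
      rw [Finsupp.single_apply, Matrix.one_apply]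
      simp only [hl.get_inj_iff]
    change Matrix.det (fun i => g (v i)) = 1
    rw [this, Matrix.det_one]
  rw [hv]
  intro h
  have := liftAlternating_apply_ιMulti (R := F) (Pi.single l.length f) v
  rw [h, map_zero, Pi.single_eq_same, hf] at this
  exact zero_ne_one this

theorem prod_upper_lower_ne_zero {T : List (ℕ × ℕ)} (h1 : (T.map Prod.fst).Nodup)
    (h2 : (T.map Prod.snd).Nodup) : (T.map fun c => upper F c.1 * lower F c.2).prod ≠ 0 := by
  have hl : (T.flatMap fun c => [2 * c.1, 2 * c.2 + 1]).Nodup := by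
    induction T with
    | nil => simp
    | cons c T ih =>
      simp only [List.map_cons, List.nodup_cons] at h1 h2
      rw [List.flatMap_cons, List.nodup_append]
      refine ⟨by simp; omega, ih h1.2 h2.2, ?_⟩
      intro a ha b hb
      obtain ⟨d, hd, hb⟩ := List.mem_flatMap.mp hb
      have n1 : c.1 ≠ d.1 := fun h => h1.1 (h ▸ List.mem_map_of_mem hd)
      have n2 : c.2 ≠ d.2 := fun h => h2.1 (h ▸ List.mem_map_of_mem hd)
      simp only [List.mem_cons, List.not_mem_nil, or_false] at ha hb
      omega
  have := prod_generators_ne_zero (F := F) hl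
  convert this using 1
  clear this hl h1 h2
  induction T with
  | nil => rfl
  | cons c T ih =>
    rw [List.map_cons, List.prod_cons, ih, List.flatMap_cons, List.map_append, List.prod_append]
    simp [upper, lower]

end Monomials

end WeakPI

namespace WeakPI

open ExteriorAlgebra

/-! ### The lower bound for the dimension -/

section LowerBound

variable {F : Type*} [Field F]

theorem linearIndependent_of_separating {ι M N : Type*} [AddCommGroup M] [Module F M]
    [AddCommGroup N] [Module F N] (q : ι → M) (φ : ι → M →ₗ[F] N) (h : ∀ i, φ i (q i) ≠ 0)
    (h' : ∀ i j, i ≠ j → φ i (q j) = 0) : LinearIndependent F q := by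
  classical
  rw [linearIndependent_iff']
  intro s g hg i hi
  have := congrArg (φ i) hg
  rw [map_sum, map_zero, Finset.sum_eq_single_of_mem i hi] at this
  · rw [map_smul] at this
    exact (smul_eq_zero.mp this).resolve_right (h i)
  · intro j _ hj
    rw [map_smul, h' i j hj.symm, smul_zero]

/-- The indices of multiplicity one. -/
def singles (n : ℕ →₀ ℕ) : Finset ℕ := n.support.filter fun i => n i = 1

/-- The indices of multiplicity two. -/
def doubles (n : ℕ →₀ ℕ) : Finset ℕ := n.support.filter fun i => n i = 2

/-- The array pairing the elements of `B` with the other indices of multiplicity one, and every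
index of multiplicity two with itself. -/
noncomputable def pairingArray (n : ℕ →₀ ℕ) (B : Finset ℕ) : List (ℕ × ℕ) :=
  B.toList.zip (singles n \ B).toList ++ (doubles n).toList.map fun i => (i, i)

theorem content_eq_count (S : List (ℕ × ℕ)) (i : ℕ) :
    content S i = (S.map Prod.fst).count i + (S.map Prod.snd).count i := by
  induction S with
  | nil => simp [content_nil]
  | cons c S ih =>
    rw [content_cons, Finsupp.add_apply, Finsupp.add_apply, ih]
    simp only [List.map_cons, List.count_cons, Finsupp.single_apply, beq_iff_eq]
    ring

variable {n : ℕ →₀ ℕ} {B : Finset ℕ}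

theorem map_fst_pairingArray (h : B.card = (singles n \ B).card) :
    (pairingArray n B).map Prod.fst = B.toList ++ (doubles n).toList := by
  rw [pairingArray, List.map_append, List.map_fst_zip (by simp [h]), List.map_map]
  simp [Function.comp_def]

theorem map_snd_pairingArray (h : B.card = (singles n \ B).card) :
    (pairingArray n B).map Prod.snd = (singles n \ B).toList ++ (doubles n).toList := by
  rw [pairingArray, List.map_append, List.map_snd_zip (by simp [h]), List.map_map]
  simp [Function.comp_def]

theorem mem_singles {i : ℕ} : i ∈ singles n ↔ n i = 1 := by
  simp only [singles, Finset.mem_filter, Finsupp.mem_support_iff]; omega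

theorem mem_doubles {i : ℕ} : i ∈ doubles n ↔ n i = 2 := by
  simp only [doubles, Finset.mem_filter, Finsupp.mem_support_iff]; omega

theorem count_toList (s : Finset ℕ) (i : ℕ) : s.toList.count i = if i ∈ s then 1 else 0 := by
  rw [List.Nodup.count (s.nodup_toList)]
  simp

theorem content_pairingArray (hn : ∀ i, n i ≤ 2) (hB : B ⊆ singles n)
    (h : B.card = (singles n \ B).card) : content (pairingArray n B) = n := by
  ext i
  rw [content_eq_count, map_fst_pairingArray h, map_snd_pairingArray h, List.count_append,
    List.count_append, count_toList, count_toList, count_toList]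
  simp only [Finset.mem_sdiff, mem_doubles, mem_singles]
  by_cases hi : i ∈ B
  · simp [hi, mem_singles.mp (hB hi)]
  · have : n i = 0 ∨ n i = 1 ∨ n i = 2 := by have := hn i; omega
    rcases this with h | h | h <;> simp [hi, h]

theorem nodup_fst_pairingArray (hB : B ⊆ singles n) (h : B.card = (singles n \ B).card) :
    ((pairingArray n B).map Prod.fst).Nodup := by
  rw [map_fst_pairingArray h, List.nodup_append]
  refine ⟨B.nodup_toList, Finset.nodup_toList _, fun a ha b hb hab => ?_⟩
  have h1 := mem_singles.mp (hB (Finset.mem_toList.mp ha))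
  have h2 := mem_doubles.mp (Finset.mem_toList.mp hb)
  subst hab
  omega

theorem nodup_snd_pairingArray (h : B.card = (singles n \ B).card) :
    ((pairingArray n B).map Prod.snd).Nodup := by
  rw [map_snd_pairingArray h, List.nodup_append]
  refine ⟨Finset.nodup_toList _, Finset.nodup_toList _, fun a ha b hb hab => ?_⟩
  have h1 := mem_singles.mp (Finset.mem_sdiff.mp (Finset.mem_toList.mp ha)).1
  have h2 := mem_doubles.mp (Finset.mem_toList.mp hb)
  subst hab
  omega

theorem coe_prod_genericPairing (f g : ℕ × ℕ → ℕ) (T : List (ℕ × ℕ)) :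
    (((T.map fun c => genericPairing F (f c) (g c)).prod : Subalgebra.center F (Grassmann F)) :
      Grassmann F) = (T.map fun c => upper F (f c) * lower F (g c)).prod := by
  induction T with
  | nil => rfl
  | cons c T ih =>
    rw [List.map_cons, List.prod_cons, List.map_cons, List.prod_cons, ← ih]
    rfl

/-- There are at least `binom(2s-1, s)` linearly independent elements in the span of the products
of skew pairings of content `n`. -/
theorem exists_linearIndependent_skewSpan (hF : ringChar F ≠ 2) (hn : ∀ i, n i ≤ 2) {s : ℕ}
    (hs : (singles n).card = 2 * s) (hD : s = 0 → Even (doubles n).card) :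
    ∃ (ι : Type) (_ : Fintype ι) (q : ι → Subalgebra.center F (Grassmann F)),
      Fintype.card ι = (2 * s - 1).choose s ∧ LinearIndependent F q ∧
        ∀ b, q b ∈ skewSpan F (genericPairing F) n := by
  classical
  have hcard : ∀ B ⊆ singles n, B.card = s → B.card = (singles n \ B).card := fun B hB hc => by
    rw [Finset.card_sdiff_of_subset hB]; omega
  -- Up to sign, the first product carries `y_i` for `i` in `B`, `z_i` for the other indices of
  -- multiplicity one, and both for multiplicity two. The pairing chosen between the two sets is
  -- immaterial.
  let Q : Finset ℕ → Subalgebra.center F (Grassmann F) := fun B =>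
    ((pairingArray n B).map fun c => genericPairing F c.1 c.2).prod + (-1) ^ (pairingArray n B).length
      * ((pairingArray n B).map fun c => genericPairing F c.2 c.1).prod
  have hQ : ∀ B ⊆ singles n, B.card = s → Q B ∈ skewSpan F (genericPairing F) n :=
    fun B hB hc => by
      have := exchange_sum_mem hF (genericPairing_exchange F) (pairingArray n B)
      rwa [content_pairingArray hn hB (hcard B hB hc)] at this
  rcases Nat.eq_zero_or_pos s with rfl | hs0
  · refine ⟨Unit, inferInstance, fun _ => Q ∅, by simp, ?_, fun _ => hQ ∅ (by simp) rfl⟩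
    rw [linearIndependent_unique_iff]
    have hP : pairingArray n ∅ = (doubles n).toList.map fun i => (i, i) := by simp [pairingArray]
    have hne := prod_upper_lower_ne_zero (F := F)
      (nodup_fst_pairingArray (n := n) (B := ∅) (by simp) (hcard ∅ (by simp) rfl))
      (nodup_snd_pairingArray (hcard ∅ (by simp) rfl))
    -- Without indices of multiplicity one, the two summands of `Q ∅` differ by this sign: they
    -- double for an even number of double indices and would cancel for an odd one.
    have hsgn : (-1 : Subalgebra.center F (Grassmann F)) ^ (doubles n).card = 1 :=
      (hD rfl).neg_one_pow
    have h2 : Q ∅ = (2 : F) •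
        ((pairingArray n ∅).map fun c => genericPairing F c.1 c.2).prod := by
      simp only [Q]
      rw [hP, List.length_map, Finset.length_toList, hsgn, one_mul, List.map_map,
        List.map_map, two_smul]
      rfl
    rw [h2]
    refine smul_ne_zero (Ring.two_ne_zero hF) fun h => hne ?_
    rw [← coe_prod_genericPairing Prod.fst Prod.snd]
    exact congrArg Subtype.val h
  · obtain ⟨i₀, hi₀⟩ : (singles n).Nonempty := Finset.card_pos.mp (by omega)
    -- Requiring `i₀` to lie in the set picks one from each pair of complementary sets. There remain
    -- `binom(2s-1, s-1) = binom(2s-1, s)` choices.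
    let I := {B' : Finset ℕ // B' ∈ ((singles n).erase i₀).powersetCard (s - 1)}
    have hI : ∀ b : I, i₀ ∉ b.1 ∧ insert i₀ b.1 ⊆ singles n ∧ (insert i₀ b.1).card = s := by
      rintro ⟨b, hb⟩
      obtain ⟨hb, hc⟩ := Finset.mem_powersetCard.mp hb
      have h0 : i₀ ∉ b := fun h => Finset.notMem_erase _ _ (hb h)
      refine ⟨h0, Finset.insert_subset hi₀ (hb.trans (Finset.erase_subset _ _)), ?_⟩
      rw [Finset.card_insert_of_notMem h0]
      omega
    -- The substitution for `b` kills `y_i` for the single indices outside its set and `z_i` inside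
    -- it. The monomials of other sets die, and so do all exchanged monomials, as they contain the
    -- lower generator of `i₀`.
    have hψ := fun b : I => exists_algHom_of_odd hF
      (fun i => if i ∈ singles n ∧ i ∉ insert i₀ b.1 then 0 else upper F i)
      (fun i => if i ∈ insert i₀ b.1 then 0 else lower F i)
      (fun i => by split_ifs; exacts [zero_mem _, upper_mem i])
      (fun i => by split_ifs; exacts [zero_mem _, lower_mem i])
    choose ψ hψ using hψ
    have hu : ∀ b i, ψ b (upper F i) =
      if i ∈ singles n ∧ i ∉ insert i₀ b.1 then 0 else upper F i := fun b i => (hψ b i).1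
    have hl : ∀ b i, ψ b (lower F i) =
      if i ∈ insert i₀ b.1 then 0 else lower F i := fun b i => (hψ b i).2
    have hswap : ∀ b b' : I, ψ b ((pairingArray n (insert i₀ b'.1)).map fun c =>
        upper F c.2 * lower F c.1).prod = 0 := fun b b' => by
      have hmem : i₀ ∈ (pairingArray n (insert i₀ b'.1)).map Prod.fst := by
        rw [map_fst_pairingArray (hcard _ (hI b').2.1 (hI b').2.2)]
        simp
      obtain ⟨c, hc, hc'⟩ := List.mem_map.mp hmem
      rw [map_list_prod, List.map_map]
      refine List.prod_eq_zero (List.mem_map.mpr ⟨c, hc, ?_⟩)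
      simp [hl, hc']
    have hne : ∀ b b' : I, b ≠ b' → ψ b ((pairingArray n (insert i₀ b'.1)).map fun c =>
        upper F c.1 * lower F c.2).prod = 0 := fun b b' hbb => by
      obtain ⟨i, hi, hi'⟩ : ∃ i ∈ insert i₀ b'.1, i ∉ insert i₀ b.1 := by
        by_contra! h
        have := Finset.eq_of_subset_of_card_le (s := insert i₀ b'.1) (t := insert i₀ b.1) h
          (by rw [(hI b).2.2, (hI b').2.2])
        refine hbb (Subtype.ext ?_)
        rw [← Finset.erase_insert (hI b).1, ← this, Finset.erase_insert (hI b').1]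
      have hmem : i ∈ (pairingArray n (insert i₀ b'.1)).map Prod.fst := by
        rw [map_fst_pairingArray (hcard _ (hI b').2.1 (hI b').2.2)]
        exact List.mem_append_left _ (Finset.mem_toList.mpr hi)
      obtain ⟨c, hc, hc'⟩ := List.mem_map.mp hmem
      rw [map_list_prod, List.map_map]
      refine List.prod_eq_zero (List.mem_map.mpr ⟨c, hc, ?_⟩)
      rw [Function.comp_apply, map_mul, hu, hc', if_pos ⟨(hI b').2.1 hi, hi'⟩, zero_mul]
    have hself : ∀ b : I, ψ b ((pairingArray n (insert i₀ b.1)).map fun c =>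
        upper F c.1 * lower F c.2).prod = ((pairingArray n (insert i₀ b.1)).map fun c =>
        upper F c.1 * lower F c.2).prod := fun b => by
      have hc := hcard _ (hI b).2.1 (hI b).2.2
      rw [map_list_prod, List.map_map]
      congr 1
      refine List.map_congr_left fun c hcm => ?_
      have h1 : c.1 ∈ (pairingArray n (insert i₀ b.1)).map Prod.fst := List.mem_map_of_mem hcm
      have h2 : c.2 ∈ (pairingArray n (insert i₀ b.1)).map Prod.snd := List.mem_map_of_mem hcm
      rw [map_fst_pairingArray hc, List.mem_append, Finset.mem_toList, Finset.mem_toList,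
        mem_doubles] at h1
      rw [map_snd_pairingArray hc, List.mem_append, Finset.mem_toList, Finset.mem_toList,
        mem_doubles, Finset.mem_sdiff] at h2
      rw [Function.comp_apply, map_mul, hu, hl, if_neg, if_neg]
      · rintro h
        have := mem_singles.mp ((hI b).2.1 h)
        rcases h2 with h2 | h2
        · exact h2.2 h
        · omega
      · rintro ⟨h, h'⟩
        have := mem_singles.mp h
        rcases h1 with h1 | h1
        · exact h' h1
        · omega
    have hval : ∀ b b' : I, ψ b (Q (insert i₀ b'.1)).1 =
        ψ b ((pairingArray n (insert i₀ b'.1)).map fun c => upper F c.1 * lower F c.2).prod := by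
      intro b b'
      have e : (Q (insert i₀ b'.1)).1 = ((pairingArray n (insert i₀ b'.1)).map fun c =>
          upper F c.1 * lower F c.2).prod + (-1) ^ (pairingArray n (insert i₀ b'.1)).length *
          ((pairingArray n (insert i₀ b'.1)).map fun c => upper F c.2 * lower F c.1).prod := by
        rw [← coe_prod_genericPairing Prod.fst Prod.snd, ← coe_prod_genericPairing Prod.snd Prod.fst]
        rfl
      rw [e, map_add, map_mul, hswap, mul_zero, add_zero]
    refine ⟨I, Finset.Subtype.fintype _, fun b => Q (insert i₀ b.1), ?_, ?_, fun b =>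
      hQ _ (hI b).2.1 (hI b).2.2⟩
    · rw [Fintype.card_coe, Finset.card_powersetCard, Finset.card_erase_of_mem hi₀, hs]
      exact Nat.choose_symm_of_eq_add (by omega)
    · refine linearIndependent_of_separating _
        (fun b => (ψ b).toLinearMap ∘ₗ (Subalgebra.center F (Grassmann F)).val.toLinearMap) ?_ ?_
      · intro b
        change ψ b (Q (insert i₀ b.1)).1 ≠ 0
        rw [hval, hself]
        exact prod_upper_lower_ne_zero
          (nodup_fst_pairingArray (hI b).2.1 (hcard _ (hI b).2.1 (hI b).2.2))
          (nodup_snd_pairingArray (hcard _ (hI b).2.1 (hI b).2.2))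
      · intro b b' hbb
        change ψ b (Q (insert i₀ b'.1)).1 = 0
        rw [hval, hne b b' hbb]

end LowerBound

end WeakPI

/-! ### The upper bound: enumerating normal arrays and comparing with ballot numbers. -/

namespace WeakPI

/-! ### Ballot numbers -/

/-- Binomial coefficients with an integral lower argument. -/
def intChoose (n : ℕ) (k : ℤ) : ℤ := if k < 0 then 0 else n.choose k.toNat

theorem intChoose_neg (n : ℕ) {k : ℤ} (hk : k < 0) : intChoose n k = 0 := if_pos hk

theorem intChoose_natCast (n k : ℕ) : intChoose n k = n.choose k := by
  simp [intChoose]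

theorem intChoose_succ (n : ℕ) (k : ℤ) :
    intChoose (n + 1) k = intChoose n k + intChoose n (k - 1) := by
  rcases lt_trichotomy k 0 with hk | rfl | hk
  · rw [intChoose_neg _ hk, intChoose_neg _ hk, intChoose_neg _ (by omega), add_zero]
  · rw [intChoose_neg n (by omega : (0 : ℤ) - 1 < 0)]
    simp [intChoose]
  · obtain ⟨j, rfl⟩ : ∃ j : ℕ, k = ((j + 1 : ℕ) : ℤ) := ⟨(k - 1).toNat, by omega⟩
    rw [show ((j + 1 : ℕ) : ℤ) - 1 = (j : ℕ) by push_cast; ring, intChoose_natCast,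
      intChoose_natCast, intChoose_natCast, Nat.choose_succ_succ]
    push_cast
    ring

/-- The ballot number `binom(n, k) - binom(n, k - 1)`. -/
def ballot (n : ℕ) (k : ℤ) : ℤ := intChoose n k - intChoose n (k - 1)

theorem ballot_succ (n : ℕ) (k : ℤ) : ballot (n + 1) k = ballot n k + ballot n (k - 1) := by
  unfold ballot
  rw [intChoose_succ, intChoose_succ n (k - 1)]
  ring

theorem ballot_neg (n : ℕ) {k : ℤ} (hk : k < 0) : ballot n k = 0 := by
  rw [ballot, intChoose_neg _ hk, intChoose_neg _ (by omega), sub_zero]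

/-- By symmetry of the binomials. This is the boundary case in which the enumeration finds `K` empty
and a move is missing. -/
theorem ballot_eq_zero {n : ℕ} {k : ℤ} (h : (n : ℤ) + 1 = 2 * k) : ballot n k = 0 := by
  obtain ⟨j, rfl⟩ : ∃ j : ℕ, k = ((j + 1 : ℕ) : ℤ) := ⟨(k - 1).toNat, by omega⟩
  rw [ballot, show ((j + 1 : ℕ) : ℤ) - 1 = (j : ℕ) by push_cast; ring, intChoose_natCast,
    intChoose_natCast, Nat.choose_symm_of_eq_add (by omega : n = j + 1 + j), sub_self]

theorem ballot_zero_left (k : ℤ) : ballot 0 k ≤ if k = 0 then 1 else 0 := by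
  rcases lt_trichotomy k 0 with hk | rfl | hk
  · rw [ballot_neg _ hk, if_neg hk.ne]
  · simp [ballot, intChoose]
  · obtain ⟨j, rfl⟩ : ∃ j : ℕ, k = ((j + 1 : ℕ) : ℤ) := ⟨(k - 1).toNat, by omega⟩
    rw [if_neg hk.ne', ballot, show ((j + 1 : ℕ) : ℤ) - 1 = (j : ℕ) by push_cast; ring,
      intChoose_natCast, intChoose_natCast]
    simp

/-! ### Enumeration of the normal arrays

A letter of multiplicity one or two is coded by a pair `(i, b)`, where `b` tells whether the
multiplicity is two. The array is built column by column. The entries of the lower row that are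
still to be used are split into the list `K` of those that are not smaller than the last
left-to-right minimum (they have to be used from left to right), and the decreasing list `σ` of the
smaller ones. The list `ρ` consists of the letters not yet reached, of which `o` are going to
enter the lower row. -/

/-- The ways to use an entry `x` of `σ`: the results are `x` and the new lists `K` and `σ`. -/
def closings : List ℕ → List (ℕ × Bool) → List (ℕ × List ℕ × List (ℕ × Bool))
  | _, [] => []
  -- A double `x` cannot be skipped: a smaller entry used before both copies of `x` would start a
  -- chain. When it is used, its other copy joins `K`. A skipped single entry also goes to the end
  -- of `K`, whose entries are all larger.
  | K, (x, true) :: σ => [(x, K ++ [x], σ)]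
  | K, (x, false) :: σ => (x, K, σ) :: closings (K ++ [x]) σ

/-- The completions of an array to which at least one column has been written. -/
def completions : ℕ → List ℕ → List (ℕ × Bool) → List (ℕ × Bool) → List (List (ℕ × ℕ))
  | _, K, σ, [] => if K = [] ∧ σ = [] then [[]] else []
  -- Nothing more enters the lower row, so `i` goes up, above the first entry of `K` or an entry of
  -- `σ`.
  | 0, K, σ, (i, false) :: ρ =>
      (K.head?.toList.flatMap fun k => (completions 0 K.tail σ ρ).map ((i, k) :: ·)) ++
      (closings K σ).flatMap fun c => (completions 0 c.2.1 c.2.2 ρ).map ((i, c.1) :: ·)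
  -- A larger letter is still to come in the lower row, so using an entry of `K` now would complete
  -- a chain with the last minimum. Either `i` goes down, or it stands above an entry of `σ`.
  | o + 1, K, σ, (i, false) :: ρ =>
      completions o (i :: K) σ ρ ++
      (closings K σ).flatMap fun c => (completions (o + 1) c.2.1 c.2.2 ρ).map ((i, c.1) :: ·)
  -- Both copies go up, with lower entries `x ≤ y`. Such a pair is only allowed for `x` in `σ`; then
  -- `y` is not below the new minimum and must be the first entry of `K`.
  | 0, K, σ, (i, true) :: ρ =>
      (closings K σ).flatMap fun c => c.2.1.head?.toList.flatMap fun k =>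
        (completions 0 c.2.1.tail c.2.2 ρ).map fun S => (i, c.1) :: (i, k) :: S
  -- Two copies in the lower row would form a chain with the last minimum, and two in the upper row
  -- would use an entry of `K` too early. So one goes up and one down.
  | o + 1, K, σ, (i, true) :: ρ =>
      (closings K σ).flatMap fun c => (completions o (i :: c.2.1) c.2.2 ρ).map ((i, c.1) :: ·)

/-- The completions of an array without columns. -/
def initialCompletions : ℕ → List (ℕ × Bool) → List (ℕ × Bool) → List (List (ℕ × ℕ))
  | _, σ, [] => if σ = [] then [[]] else []
  | o, σ, (i, false) :: ρ =>
      (if 1 ≤ o then initialCompletions (o - 1) ((i, false) :: σ) ρ else []) ++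
      (closings [] σ).flatMap fun c => (completions o c.2.1 c.2.2 ρ).map ((i, c.1) :: ·)
  -- Only before the first column may both copies go down.
  | o, σ, (i, true) :: ρ =>
      (if 2 ≤ o then initialCompletions (o - 2) ((i, true) :: σ) ρ else []) ++
      completions o [] σ ((i, true) :: ρ)

/-- The number of letters of multiplicity one. -/
def numSingle (l : List (ℕ × Bool)) : ℕ := l.countP fun x => !x.2

/-- The number of letters of multiplicity two. -/
def numDouble (l : List (ℕ × Bool)) : ℕ := l.countP fun x => x.2

@[simp] theorem numSingle_nil : numSingle [] = 0 := rfl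

@[simp] theorem numDouble_nil : numDouble [] = 0 := rfl

@[simp] theorem numSingle_cons_false (i : ℕ) (l : List (ℕ × Bool)) :
    numSingle ((i, false) :: l) = numSingle l + 1 := by simp [numSingle]

@[simp] theorem numSingle_cons_true (i : ℕ) (l : List (ℕ × Bool)) :
    numSingle ((i, true) :: l) = numSingle l := by simp [numSingle]

@[simp] theorem numDouble_cons_false (i : ℕ) (l : List (ℕ × Bool)) :
    numDouble ((i, false) :: l) = numDouble l := by simp [numDouble]

@[simp] theorem numDouble_cons_true (i : ℕ) (l : List (ℕ × Bool)) :
    numDouble ((i, true) :: l) = numDouble l + 1 := by simp [numDouble]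

theorem length_eq_numSingle_add_numDouble (l : List (ℕ × Bool)) :
    l.length = numSingle l + numDouble l := by
  induction l with
  | nil => rfl
  | cons x l ih =>
    obtain ⟨i, _ | _⟩ := x <;> simp <;> omega

theorem size_of_mem_closings {K : List ℕ} {σ : List (ℕ × Bool)}
    {c : ℕ × List ℕ × List (ℕ × Bool)} (hc : c ∈ closings K σ) :
    c.2.1.length + numSingle c.2.2 + 2 * numDouble c.2.2 + 1
      = K.length + numSingle σ + 2 * numDouble σ := by
  induction σ generalizing K with
  | nil => simp [closings] at hc
  | cons x σ ih =>
    obtain ⟨x, _ | _⟩ := x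
    · rw [closings, List.mem_cons] at hc
      rcases hc with rfl | hc
      · simp; omega
      · have := ih hc
        simp at this ⊢
        omega
    · rw [closings, List.mem_singleton] at hc
      subst hc
      simp
      omega

/-- Each single entry of `σ` is either used or skipped, and `ballot_succ` adds the two
contributions. In the applications `r` and `D` count the single and double letters left after the
current one. -/
theorem sum_closings_le {r D : ℕ} {K : List ℕ} {σ : List (ℕ × Bool)}
    {f : ℕ × List ℕ × List (ℕ × Bool) → ℕ}
    (hf : ∀ c ∈ closings K σ, (f c : ℤ) ≤ ballot (numSingle c.2.2 + r) (c.2.2.length - D)) :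
    (((closings K σ).map f).sum : ℤ) ≤ ballot (numSingle σ + r) (σ.length - D - 1) := by
  induction σ generalizing K with
  | nil =>
    rw [ballot_neg _ (by simp; omega)]
    simp [closings]
  | cons x σ ih =>
    obtain ⟨x, _ | _⟩ := x
    · rw [closings] at hf ⊢
      have h1 := hf _ List.mem_cons_self
      have h2 := ih fun c hc => hf c (List.mem_cons_of_mem _ hc)
      rw [List.map_cons, List.sum_cons, numSingle_cons_false, List.length_cons,
        show numSingle σ + 1 + r = numSingle σ + r + 1 by ring, ballot_succ]
      push_cast at h1 h2 ⊢
      rw [show (σ.length : ℤ) + 1 - D - 1 = σ.length - D by ring]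
      exact add_le_add h1 h2
    · rw [closings] at hf ⊢
      have h1 := hf _ List.mem_cons_self
      rw [List.map_singleton, List.sum_singleton, numSingle_cons_true, List.length_cons]
      push_cast
      rw [show (σ.length : ℤ) + 1 - D - 1 = σ.length - D by ring]
      exact h1

/-- The hypothesis says that equally many places are left in both rows. A single letter has one move
that keeps `σ`, besides the closings: these match the two terms of `ballot_succ`. A double letter
has only closings, followed by a forced choice. Where the forced entry of `K` does not exist, the
ballot number is zero. -/
theorem length_completions_le (ρ : List (ℕ × Bool)) (o : ℕ) (K : List ℕ) (σ : List (ℕ × Bool))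
    (h : numSingle ρ + 2 * numDouble ρ = K.length + numSingle σ + 2 * numDouble σ + 2 * o) :
    ((completions o K σ ρ).length : ℤ)
      ≤ ballot (numSingle σ + numSingle ρ) (σ.length - numDouble ρ) := by
  induction ρ generalizing o K σ with
  | nil =>
    have hl := length_eq_numSingle_add_numDouble σ
    simp only [numSingle_nil, numDouble_nil] at h
    obtain rfl : K = [] := List.eq_nil_of_length_eq_zero (by omega)
    obtain rfl : σ = [] := List.eq_nil_of_length_eq_zero (by omega)
    cases o <;> simp [completions, ballot, intChoose]
  | cons x ρ ih =>
    have hl := length_eq_numSingle_add_numDouble σ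
    obtain ⟨i, _ | _⟩ := x
    · simp only [numSingle_cons_false, numDouble_cons_false] at h ⊢
      have hcl : (((closings K σ).map fun c => (completions o c.2.1 c.2.2 ρ).length).sum : ℤ)
          ≤ ballot (numSingle σ + numSingle ρ) (σ.length - numDouble ρ - 1) := by
        refine sum_closings_le fun c hc => ih _ _ _ ?_
        have := size_of_mem_closings hc
        omega
      rw [show numSingle σ + (numSingle ρ + 1) = numSingle σ + numSingle ρ + 1 by ring, ballot_succ]
      cases o with
      | zero =>
        simp only [completions, List.length_append, List.length_flatMap, List.length_map]
        rw [Nat.cast_add]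
        refine add_le_add ?_ hcl
        cases K with
        | nil =>
          rw [ballot_eq_zero]
          · simp
          · simp at h; push_cast [hl]; omega
        | cons k K =>
          simp at h ⊢
          exact ih 0 K σ (by omega)
      | succ o =>
        simp only [completions, List.length_append, List.length_flatMap, List.length_map]
        rw [Nat.cast_add]
        refine add_le_add (ih _ _ _ ?_) hcl
        simp
        omega
    · simp only [numSingle_cons_true, numDouble_cons_true] at h ⊢
      push_cast
      rw [← sub_sub]
      cases o with
      | zero =>
        simp only [completions, List.length_flatMap, List.length_map]
        refine sum_closings_le fun c hc => ?_
        have hs := size_of_mem_closings hc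
        have hl' := length_eq_numSingle_add_numDouble c.2.2
        obtain ⟨x, K', σ'⟩ := c
        cases K' with
        | nil =>
          rw [ballot_eq_zero]
          · simp
          · simp at hs hl' ⊢; push_cast [hl']; omega
        | cons k K' =>
          simp at hs ⊢
          exact ih 0 K' σ' (by omega)
      | succ o =>
        simp only [completions, List.length_flatMap, List.length_map]
        refine sum_closings_le fun c hc => ih _ _ _ ?_
        have := size_of_mem_closings hc
        simp
        omega

/-- The ballot numbers for the possible places of the first column telescope. At the start `o` is
half the degree, so the subtracted binomial vanishes. -/
theorem length_initialCompletions_le {s : ℕ} (hs : 0 < s) (ρ : List (ℕ × Bool)) (o : ℕ)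
    (σ : List (ℕ × Bool))
    (h : numSingle ρ + 2 * numDouble ρ = numSingle σ + 2 * numDouble σ + 2 * o)
    (hL : numSingle σ + numSingle ρ = 2 * s) :
    ((initialCompletions o σ ρ).length : ℤ)
      ≤ intChoose (2 * s - 1) s - intChoose (2 * s - 1) (s - o - 2) := by
  obtain ⟨s, rfl⟩ : ∃ r, s = r + 1 := ⟨s - 1, by omega⟩
  -- This symmetry ends the telescoping at a letter that can no longer go down.
  have hsymm : intChoose (2 * (s + 1) - 1) ((s + 1 : ℕ) : ℤ) = intChoose (2 * (s + 1) - 1) s := by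
    rw [intChoose_natCast, intChoose_natCast, Nat.choose_symm_of_eq_add
      (by omega : 2 * (s + 1) - 1 = s + 1 + s)]
  induction ρ generalizing o σ with
  | nil => simp at h hL; omega
  | cons x ρ ih =>
    have hl := length_eq_numSingle_add_numDouble σ
    obtain ⟨i, _ | _⟩ := x
    · simp only [numSingle_cons_false, numDouble_cons_false] at h hL
      have hcl : (((closings [] σ).map fun c => (completions o c.2.1 c.2.2 ρ).length).sum : ℤ)
          ≤ ballot (numSingle σ + numSingle ρ) (σ.length - numDouble ρ - 1) := by
        refine sum_closings_le fun c hc => length_completions_le _ _ _ _ ?_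
        have := size_of_mem_closings hc
        simp at this
        omega
      rw [show numSingle σ + numSingle ρ = 2 * (s + 1) - 1 by omega,
        show (σ.length : ℤ) - numDouble ρ - 1 = s - o by push_cast [hl]; omega, ballot] at hcl
      simp only [initialCompletions, List.length_append, List.length_flatMap, List.length_map]
      rw [Nat.cast_add, Nat.cast_add, Nat.cast_one]
      rw [show (s : ℤ) + 1 - o - 2 = s - o - 1 by ring]
      split_ifs with ho
      · have := ih (o - 1) ((i, false) :: σ) (by simp; omega) (by simp; omega)
        rw [show ((s + 1 : ℕ) : ℤ) - ((o - 1 : ℕ) : ℤ) - 2 = s - o by omega] at this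
        push_cast at this
        linarith
      · obtain rfl : o = 0 := by omega
        push_cast at hsymm
        simp at hcl hsymm ⊢
        linarith
    · have hco := length_completions_le ((i, true) :: ρ) o [] σ (by simpa using h)
      simp only [numSingle_cons_true, numDouble_cons_true] at h hL hco
      rw [hL, show (σ.length : ℤ) - ((numDouble ρ + 1 : ℕ) : ℤ) = s + 1 - o by
        push_cast [hl]; omega, ballot, show 2 * (s + 1) = 2 * (s + 1) - 1 + 1 by omega,
        intChoose_succ, intChoose_succ] at hco
      simp only [initialCompletions, List.length_append]
      push_cast
      rw [show (s : ℤ) + 1 - o - 1 = s - o by ring] at hco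
      rw [show (s : ℤ) + 1 - o - 2 = s - o - 1 by ring]
      split_ifs with ho
      · have := ih (o - 2) ((i, true) :: σ) (by simp; omega) (by simp; omega)
        rw [show ((s + 1 : ℕ) : ℤ) - ((o - 2 : ℕ) : ℤ) - 2 = s + 1 - o by omega] at this
        push_cast at this
        linarith
      · obtain rfl | rfl : o = 0 ∨ o = 1 := by omega
        · push_cast at hsymm
          simp at hco hsymm ⊢
          linarith
        · push_cast at hsymm
          simp at hco hsymm ⊢
          linarith

/-- `ballot 0 k` is positive only for `k = 0`, so the first column can start only when `o = 0`,
while before it `o` drops in steps of two. -/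
theorem length_initialCompletions_le_of_numSingle_eq_zero (ρ : List (ℕ × Bool)) (o : ℕ)
    (σ : List (ℕ × Bool))
    (h : 2 * numDouble ρ = 2 * numDouble σ + 2 * o) (hσ : numSingle σ = 0) (hρ : numSingle ρ = 0) :
    (initialCompletions o σ ρ).length ≤ if Even o then 1 else 0 := by
  induction ρ generalizing o σ with
  | nil =>
    have hl := length_eq_numSingle_add_numDouble σ
    rw [numDouble_nil] at h
    obtain rfl : σ = [] := List.eq_nil_of_length_eq_zero (by omega)
    obtain rfl : o = 0 := by omega
    simp [initialCompletions]
  | cons x ρ ih =>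
    have hl := length_eq_numSingle_add_numDouble σ
    obtain ⟨i, _ | _⟩ := x
    · simp at hρ
    · have hco := length_completions_le ((i, true) :: ρ) o [] σ (by simpa [hσ, hρ] using h)
      simp only [numSingle_cons_true, numDouble_cons_true] at h hρ hco
      rw [hσ, hρ, show (σ.length : ℤ) - ((numDouble ρ + 1 : ℕ) : ℤ) = -o by
        push_cast [hl]; omega] at hco
      have hco' := hco.trans (ballot_zero_left _)
      simp only [initialCompletions, List.length_append]
      by_cases ho : 2 ≤ o
      · rw [if_pos ho]
        have := ih (o - 2) ((i, true) :: σ) (by simp; omega) (by simpa) hρ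
        rw [if_neg (by omega)] at hco'
        have he : Even (o - 2) ↔ Even o := by rw [Nat.even_sub ho]; simp
        simp only [he] at this
        omega
      · rw [if_neg ho]
        obtain rfl | rfl : o = 0 ∨ o = 1 := by omega
        · simp at hco' ⊢; omega
        · simp at hco' ⊢; exact hco'

end WeakPI

namespace WeakPI

/-! ### Completeness of the enumeration -/

/-- The multiset of the letters, with multiplicities. -/
def letters : List (ℕ × Bool) → Multiset ℕ
  | [] => 0
  | (i, false) :: l => i ::ₘ letters l
  | (i, true) :: l => i ::ₘ i ::ₘ letters l

theorem mem_letters {l : List (ℕ × Bool)} {i : ℕ} : i ∈ letters l ↔ i ∈ l.map Prod.fst := by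
  induction l with
  | nil => simp [letters]
  | cons x l ih => obtain ⟨j, _ | _⟩ := x <;> simp [letters, ih]

/-- A c-array without three columns forming a chain. -/
structure IsChainFree (S : List (ℕ × ℕ)) : Prop where
  gt : ∀ c ∈ S, c.2 < c.1
  sorted : S.Pairwise fun c d => c.1 < d.1 ∨ (c.1 = d.1 ∧ c.2 ≤ d.2)
  avoids : ∀ c d e, [c, d, e].Sublist S → ¬ (c.2 ≤ d.2 ∧ d.2 ≤ e.2)

theorem IsChainFree.tail {c : ℕ × ℕ} {S : List (ℕ × ℕ)} (h : IsChainFree (c :: S)) :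
    IsChainFree S where
  gt d hd := h.gt d (List.mem_cons_of_mem _ hd)
  sorted := (List.pairwise_cons.mp h.sorted).2
  avoids d e f hs := h.avoids d e f (hs.cons _)

/-- After a column with lower entry `x`, only entries below `x` can start an increasing pair. -/
theorem IsChainFree.pairwise_tail {c : ℕ × ℕ} {S : List (ℕ × ℕ)} (h : IsChainFree (c :: S)) :
    S.Pairwise fun d e => d.2 ≤ e.2 → d.2 < c.2 := by
  rw [List.pairwise_iff_forall_sublist]
  intro d e hs hde
  by_contra hlt
  exact h.avoids c d e (hs.cons_cons _) ⟨not_lt.mp hlt, hde⟩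

/-- The state of the enumeration after at least one column; `m` is the last left-to-right minimum
of the lower row. -/
structure IsState (m : ℕ) (K : List ℕ) (σ ρ : List (ℕ × Bool)) : Prop where
  sorted_K : K.Pairwise (· > ·)
  le_K : ∀ k ∈ K, m ≤ k
  sorted_σ : (σ.map Prod.fst).Pairwise (· > ·)
  σ_lt : ∀ y ∈ letters σ, y < m
  sorted_ρ : (ρ.map Prod.fst).Pairwise (· < ·)
  le_ρ : ∀ j ∈ letters ρ, m ≤ j
  K_lt_ρ : ∀ k ∈ K, ∀ j ∈ letters ρ, k < j

/-- The entries of `σ` above `x` are skipped, which `hd` permits because all of them are single;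
appended to `K` they keep it decreasing. -/
theorem exists_mem_closings {K : List ℕ} {σ : List (ℕ × Bool)} {x : ℕ}
    (hK : K.Pairwise (· > ·)) (hσ : (σ.map Prod.fst).Pairwise (· > ·))
    (hKσ : ∀ k ∈ K, ∀ y ∈ letters σ, y < k) (hx : x ∈ letters σ)
    (hd : ∀ y, (y, true) ∈ σ → y ≤ x) :
    ∃ K' σ', (x, K', σ') ∈ closings K σ ∧
      x ::ₘ ((K' : Multiset ℕ) + letters σ') = (K : Multiset ℕ) + letters σ ∧
      K'.Pairwise (· > ·) ∧ (∀ k ∈ K', x ≤ k) ∧ (σ'.map Prod.fst).Pairwise (· > ·) ∧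
      ∀ y ∈ letters σ', y < x := by
  induction σ generalizing K with
  | nil => simp [letters] at hx
  | cons z σ ih =>
    obtain ⟨z, b⟩ := z
    rw [List.map_cons, List.pairwise_cons] at hσ
    have hz : ∀ y ∈ letters σ, y < z := fun y hy => hσ.1 y (mem_letters.mp hy)
    have hzσ : z ∈ letters ((z, b) :: σ) := by cases b <;> simp [letters]
    have hsub : ∀ y ∈ letters σ, y ∈ letters ((z, b) :: σ) := fun y hy => by
      cases b <;> simp [letters, hy]
    have hKz : (K ++ [z]).Pairwise (· > ·) := by
      rw [List.pairwise_append]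
      refine ⟨hK, List.pairwise_singleton _ _, fun k hk y hy => ?_⟩
      rw [List.mem_singleton.mp hy]
      exact hKσ k hk z hzσ
    by_cases hxz : x = z
    · subst hxz
      cases b with
      | false =>
        refine ⟨K, σ, by simp [closings], by simp [letters], hK,
          fun k hk => (hKσ k hk x hzσ).le, hσ.2, hz⟩
      | true =>
        refine ⟨K ++ [x], σ, by simp [closings], ?_, hKz, fun k hk => ?_, hσ.2, hz⟩
        · rw [← Multiset.coe_add, letters]
          simp only [Multiset.coe_singleton, Multiset.add_cons, add_assoc, Multiset.singleton_add]
        · rcases List.mem_append.mp hk with hk | hk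
          · exact (hKσ k hk x hzσ).le
          · rw [List.mem_singleton.mp hk]
    · have hx' : x ∈ letters σ := by
        cases b <;> simpa [letters, hxz] using hx
      cases b with
      | true => exact absurd (hd z List.mem_cons_self) (not_le.mpr (hz x hx'))
      | false =>
        obtain ⟨K', σ', h1, h2, h3⟩ := ih hKz hσ.2 (fun k hk y hy => by
            rcases List.mem_append.mp hk with hk | hk
            · exact hKσ k hk y (hsub y hy)
            · rw [List.mem_singleton.mp hk]; exact hz y hy) hx'
          (fun y hy => hd y (List.mem_cons_of_mem _ hy))
        refine ⟨K', σ', by rw [closings]; exact List.mem_cons_of_mem _ h1, ?_, h3⟩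
        rw [h2, ← Multiset.coe_add, letters]
        simp only [Multiset.coe_singleton, Multiset.add_cons, add_assoc, Multiset.singleton_add]

theorem two_le_count_of_mem_true {σ : List (ℕ × Bool)} {y : ℕ} (h : (y, true) ∈ σ) :
    2 ≤ (letters σ).count y := by
  induction σ with
  | nil => simp at h
  | cons z σ ih =>
    rcases List.mem_cons.mp h with rfl | h
    · simp [letters]
    · have := ih h
      obtain ⟨z, _ | _⟩ := z <;> simp only [letters, Multiset.count_cons] <;> omega

/-- Two columns with the same lower entry. -/
theorem exists_sublist_of_two_le_count {S : List (ℕ × ℕ)} {y : ℕ}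
    (h : 2 ≤ (S.map Prod.snd).count y) :
    ∃ c d : ℕ × ℕ, [c, d].Sublist S ∧ c.2 = y ∧ d.2 = y := by
  have h1 : (List.replicate 2 y).Sublist (S.map Prod.snd) := List.replicate_sublist_iff.mpr h
  obtain ⟨l, hl, he⟩ := List.sublist_map_iff.mp h1
  obtain ⟨c, d, rfl⟩ := List.length_eq_two.mp (by simpa using (congrArg List.length he).symm)
  simp only [List.replicate, List.map_cons, List.map_nil, List.cons.injEq, and_true] at he
  exact ⟨c, d, hl, he.1.symm, he.2.symm⟩

/-- If the smallest remaining letter occurs in the upper row, it is the first entry there. -/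
theorem exists_eq_cons {S : List (ℕ × ℕ)} (hS : IsChainFree S) {i : ℕ}
    (hi : i ∈ S.map Prod.fst) (hle : ∀ j ∈ S.map Prod.fst, i ≤ j) :
    ∃ x T, S = (i, x) :: T := by
  match S, hS, hi, hle with
  | (a, x) :: T, hS, hi, hle =>
    have h1 : i ≤ a := hle a (by simp)
    have h2 : a ≤ i := by
      rw [List.map_cons, List.mem_cons] at hi
      rcases hi with rfl | hi
      · exact le_rfl
      · obtain ⟨c, hc, rfl⟩ := List.mem_map.mp hi
        have := (List.pairwise_cons.mp hS.sorted).1 c hc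
        dsimp only at this
        omega
    exact ⟨x, T, by rw [le_antisymm h1 h2]⟩

/-- Using an entry of `σ` leads to a new state. -/
theorem exists_isState_of_mem_letters {K : List ℕ} {σ ρ : List (ℕ × Bool)} {O : Multiset ℕ}
    {S : List (ℕ × ℕ)} {i x : ℕ} (hS : IsChainFree ((i, x) :: S))
    (hK : K.Pairwise (· > ·)) (hσ : (σ.map Prod.fst).Pairwise (· > ·))
    (hρ : (ρ.map Prod.fst).Pairwise (· < ·)) (hKσ : ∀ k ∈ K, ∀ y ∈ letters σ, y < k)
    (hlt : ∀ y ∈ (K : Multiset ℕ) + letters σ, ∀ j ∈ letters ρ, y < j) (hx : x ∈ letters σ)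
    (hsnd : x ::ₘ (S.map Prod.snd : Multiset ℕ) = (K : Multiset ℕ) + letters σ + O) :
    ∃ K' σ', (x, K', σ') ∈ closings K σ ∧ IsState x K' σ' ρ ∧
      (∀ k ∈ K', k ∈ (K : Multiset ℕ) + letters σ) ∧
      (S.map Prod.snd : Multiset ℕ) = (K' : Multiset ℕ) + letters σ' + O := by
  obtain ⟨K', σ', h1, h2, h3, h4, h5, h6⟩ := exists_mem_closings hK hσ hKσ hx fun y hy => by
    by_contra hlt'
    have hc := two_le_count_of_mem_true hy
    have hc' : 2 ≤ (S.map Prod.snd).count y := by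
      have := congrArg (Multiset.count y) hsnd
      rw [Multiset.count_cons_of_ne (by omega), Multiset.count_add, Multiset.count_add,
        Multiset.coe_count] at this
      omega
    obtain ⟨c, d, hs, hc, hd⟩ := exists_sublist_of_two_le_count hc'
    exact hS.avoids (i, x) c d (hs.cons_cons _) ⟨by dsimp only; omega, by omega⟩
  have hK' : ∀ k ∈ K', k ∈ (K : Multiset ℕ) + letters σ := fun k hk => by
    rw [← h2]
    simp [hk]
  refine ⟨K', σ', h1, ⟨h3, h4, h5, h6, hρ, fun j hj => ?_, fun k hk j hj => ?_⟩, hK', ?_⟩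
  · exact (hlt x (Multiset.mem_add.mpr (.inr hx)) j hj).le
  · exact hlt k (hK' k hk) j hj
  · rw [← h2, Multiset.cons_add] at hsnd
    exact (Multiset.cons_inj_right x).mp hsnd

/-- An entry that is not below the last minimum is the first one of `K`, and no letter remains to
enter the lower row. -/
theorem eq_cons_of_mem {m : ℕ} {K : List ℕ} {σ : List (ℕ × Bool)} {O : Multiset ℕ}
    {S : List (ℕ × ℕ)} {i x : ℕ} (hK : K.Pairwise (· > ·)) (hm : m ≤ x) (hxK : x ∈ K)
    (hO : ∀ j ∈ O, x < j)
    (hb : ((i, x) :: S).Pairwise fun d e => d.2 ≤ e.2 → d.2 < m)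
    (hsnd : x ::ₘ (S.map Prod.snd : Multiset ℕ) = (K : Multiset ℕ) + letters σ + O) :
    O = 0 ∧ ∃ K', K = x :: K' := by
  have key : ∀ y ∈ S.map Prod.snd, ¬ x ≤ y := fun y hy hxy => by
    obtain ⟨c, hc, rfl⟩ := List.mem_map.mp hy
    exact absurd ((List.pairwise_cons.mp hb).1 c hc hxy) (not_lt.mpr hm)
  have hmem : ∀ y, y ∈ (K : Multiset ℕ) + letters σ + O → y ≠ x → y ∈ S.map Prod.snd :=
    fun y hy hne => by
      rw [← hsnd, Multiset.mem_cons] at hy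
      exact Multiset.mem_coe.mp (hy.resolve_left hne)
  refine ⟨Multiset.eq_zero_of_forall_notMem fun j hj => ?_, ?_⟩
  · exact key j (hmem j (Multiset.mem_add.mpr (.inr hj)) (hO j hj).ne') (hO j hj).le
  · match K, hK, hxK with
    | k :: K', hK, hxK =>
      refine ⟨K', ?_⟩
      rcases List.mem_cons.mp hxK with rfl | h
      · rfl
      · have h1 := (List.pairwise_cons.mp hK).1 x h
        exact absurd h1.le (key k (hmem k (by simp) h1.ne'))

/-- Since the enumeration only serves as an upper bound, it suffices that every array is listed. `O`
consists of the letters of `ρ` that will enter the lower row, and `hb` is what chain-freeness with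
the columns already written imposes on the rest. -/
theorem mem_completions {m o : ℕ} {K : List ℕ} {σ ρ : List (ℕ × Bool)} {O : Multiset ℕ}
    {S : List (ℕ × ℕ)} (hst : IsState m K σ ρ) (hS : IsChainFree S)
    (hb : S.Pairwise fun d e => d.2 ≤ e.2 → d.2 < m)
    (ho : Multiset.card O = o) (hfst : (S.map Prod.fst : Multiset ℕ) + O = letters ρ)
    (hsnd : (S.map Prod.snd : Multiset ℕ) = (K : Multiset ℕ) + letters σ + O) :
    S ∈ completions o K σ ρ := by
  induction ρ generalizing m o K σ O S with
  | nil =>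
    obtain ⟨h1, rfl⟩ : (S.map Prod.fst : Multiset ℕ) = 0 ∧ O = 0 := by
      simpa [letters] using hfst
    obtain rfl : S = [] := by simpa using h1
    have h2 : K = [] ∧ letters σ = 0 := by simpa using hsnd.symm
    have h3 : σ = [] := by
      match σ, h2.2 with
      | [], _ => rfl
      | (_, false) :: _, h => simp [letters] at h
      | (_, true) :: _, h => simp [letters] at h
    cases o <;> simp [completions, h2.1, h3]
  | cons z ρ ih =>
    obtain ⟨i, b⟩ := z
    have hρ := hst.sorted_ρ
    rw [List.map_cons, List.pairwise_cons] at hρ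
    have hiρ : i ∈ letters ((i, b) :: ρ) := by cases b <;> simp [letters]
    have hsub : ∀ j ∈ letters ρ, j ∈ letters ((i, b) :: ρ) := fun j hj => by
      cases b <;> simp [letters, hj]
    have hilt : ∀ j ∈ letters ρ, i < j := fun j hj => hρ.1 j (mem_letters.mp hj)
    have hile : ∀ j ∈ letters ((i, b) :: ρ), i ≤ j := fun j hj => by
      rw [mem_letters, List.map_cons, List.mem_cons] at hj
      rcases hj with rfl | hj
      exacts [le_rfl, (hρ.1 j hj).le]
    have hmi : m ≤ i := hst.le_ρ i hiρ
    have hKi : ∀ k ∈ K, k < i := fun k hk => hst.K_lt_ρ k hk i hiρ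
    have hiO : ∀ j ∈ O, i ≤ j := fun j hj =>
      hile j (hfst ▸ Multiset.mem_add.mpr (.inr hj))
    have hKσ : ∀ k ∈ K, ∀ y ∈ letters σ, y < k := fun k hk y hy =>
      (hst.σ_lt y hy).trans_le (hst.le_K k hk)
    have hlt : ∀ y ∈ (K : Multiset ℕ) + letters σ, ∀ j ∈ letters ρ, y < j := fun y hy j hj => by
      rcases Multiset.mem_add.mp hy with hy | hy
      · exact (hKi y (Multiset.mem_coe.mp hy)).trans (hilt j hj)
      · exact ((hst.σ_lt y hy).trans_le hmi).trans (hilt j hj)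
    have hopen : ∀ {K' : List ℕ} {σ' : List (ℕ × Bool)} {m' : ℕ}, IsState m' K' σ' ρ →
        (∀ k ∈ K', k < i) → m' ≤ i → IsState m' (i :: K') σ' ρ := fun h h' hm' =>
      ⟨List.pairwise_cons.mpr ⟨h', h.sorted_K⟩, fun k hk => by
        rcases List.mem_cons.mp hk with rfl | hk
        exacts [hm', h.le_K k hk], h.sorted_σ, h.σ_lt, h.sorted_ρ, h.le_ρ, fun k hk j hj => by
        rcases List.mem_cons.mp hk with rfl | hk
        exacts [hilt j hj, h.K_lt_ρ k hk j hj]⟩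
    have hst' : IsState m K σ ρ :=
      ⟨hst.sorted_K, hst.le_K, hst.sorted_σ, hst.σ_lt, hρ.2, fun j hj => hst.le_ρ j (hsub j hj),
        fun k hk j hj => hst.K_lt_ρ k hk j (hsub j hj)⟩
    have hpop : ∀ {m' k : ℕ} {K' : List ℕ} {σ' : List (ℕ × Bool)},
        IsState m' (k :: K') σ' ρ → IsState m' K' σ' ρ := fun h =>
      ⟨(List.pairwise_cons.mp h.sorted_K).2, fun k hk => h.le_K k (List.mem_cons_of_mem _ hk),
        h.sorted_σ, h.σ_lt, h.sorted_ρ, h.le_ρ, fun k hk => h.K_lt_ρ k (List.mem_cons_of_mem _ hk)⟩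
    by_cases hi : i ∈ S.map Prod.fst
    · obtain ⟨x, T, rfl⟩ := exists_eq_cons hS hi fun j hj =>
        hile j (hfst ▸ Multiset.mem_add.mpr (.inl hj))
      have hxi : x < i := hS.gt (i, x) List.mem_cons_self
      have hxO : ∀ j ∈ O, x < j := fun j hj => hxi.trans_le (hiO j hj)
      rw [List.map_cons, ← Multiset.cons_coe] at hfst hsnd
      have hx : x ∈ K ∨ x ∈ letters σ := by
        have h : x ∈ (K : Multiset ℕ) + letters σ + O := hsnd ▸ Multiset.mem_cons_self _ _
        rcases Multiset.mem_add.mp h with h | h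
        · exact Multiset.mem_add.mp h
        · exact absurd (hxO x h) (lt_irrefl x)
      have hKx : ∀ k ∈ (K : Multiset ℕ) + letters σ, k < i := fun k hk => by
        rcases Multiset.mem_add.mp hk with hk | hk
        · exact hKi k hk
        · exact (hst.σ_lt k hk).trans_le hmi
      cases b with
      | false =>
        rw [letters, Multiset.cons_add] at hfst
        have hfst' := (Multiset.cons_inj_right i).mp hfst
        have hright : x ∈ letters σ → (i, x) :: T ∈ (closings K σ).flatMap fun c =>
            (completions o c.2.1 c.2.2 ρ).map ((i, c.1) :: ·) := fun hx => by
          obtain ⟨K', σ', h1, h2, _, h3⟩ := exists_isState_of_mem_letters hS hst.sorted_K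
            hst.sorted_σ hρ.2 hKσ hlt hx hsnd
          exact List.mem_flatMap.mpr ⟨_, h1, List.mem_map.mpr
            ⟨T, ih h2 hS.tail hS.pairwise_tail ho hfst' h3, rfl⟩⟩
        rcases hx with hx | hx
        · obtain ⟨rfl, K', rfl⟩ := eq_cons_of_mem hst.sorted_K (hst.le_K x hx) hx hxO hb hsnd
          obtain rfl : o = 0 := by simpa using ho.symm
          rw [completions]
          refine List.mem_append_left _ ?_
          rw [← Multiset.cons_coe, Multiset.cons_add, Multiset.cons_add] at hsnd
          simpa using ih (hpop hst') hS.tail (List.pairwise_cons.mp hb).2 rfl hfst'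
            ((Multiset.cons_inj_right x).mp hsnd)
        · cases o <;> rw [completions] <;> exact List.mem_append_right _ (hright hx)
      | true =>
        rw [letters, Multiset.cons_add] at hfst
        have hfst' := (Multiset.cons_inj_right i).mp hfst
        have hiT : i ∈ O ∨ i ∈ T.map Prod.fst := by
          have h : i ∈ (T.map Prod.fst : Multiset ℕ) + O := hfst' ▸ Multiset.mem_cons_self _ _
          exact (Multiset.mem_add.mp h).symm
        rcases hiT with hiT | hiT
        · obtain ⟨O', rfl⟩ := Multiset.exists_cons_of_mem hiT
          obtain rfl : o = Multiset.card O' + 1 := by simpa using ho.symm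
          rcases hx with hx | hx
          · exact absurd (eq_cons_of_mem hst.sorted_K (hst.le_K x hx) hx hxO hb hsnd).1
              (Multiset.cons_ne_zero)
          · obtain ⟨K', σ', h1, h2, h3, h4⟩ := exists_isState_of_mem_letters hS hst.sorted_K
              hst.sorted_σ hρ.2 hKσ hlt hx hsnd
            rw [completions]
            refine List.mem_flatMap.mpr ⟨_, h1, List.mem_map.mpr ⟨T, ?_, rfl⟩⟩
            rw [Multiset.add_cons] at hfst' h4
            refine ih (hopen h2 (fun k hk => hKx k (h3 k hk)) hxi.le) hS.tail hS.pairwise_tail rfl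
              ((Multiset.cons_inj_right i).mp hfst') ?_
            rw [← Multiset.cons_coe, Multiset.cons_add, Multiset.cons_add]
            exact h4
        · obtain ⟨y, U, rfl⟩ := exists_eq_cons hS.tail hiT fun j hj =>
            hile j (by
              rw [letters, ← hfst']
              exact Multiset.mem_cons_of_mem (Multiset.mem_add.mpr (.inl hj)))
          have hyi : y < i := hS.gt (i, y) (by simp)
          have hxy : x ≤ y := by
            have := (List.pairwise_cons.mp hS.sorted).1 (i, y) List.mem_cons_self
            dsimp only at this
            omega
          have hxσ : x ∈ letters σ := by
            refine hx.resolve_left fun hxK => ?_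
            have := (List.pairwise_cons.mp hb).1 (i, y) List.mem_cons_self hxy
            exact absurd this (not_lt.mpr (hst.le_K x hxK))
          obtain ⟨K', σ', h1, h2, h3, h4⟩ := exists_isState_of_mem_letters hS hst.sorted_K
            hst.sorted_σ hρ.2 hKσ hlt hxσ hsnd
          rw [List.map_cons, ← Multiset.cons_coe] at h4 hfst'
          have hyO : ∀ j ∈ O, y < j := fun j hj => hyi.trans_le (hiO j hj)
          have hyK : y ∈ K' := by
            have h : y ∈ (K' : Multiset ℕ) + letters σ' + O := h4 ▸ Multiset.mem_cons_self _ _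
            rcases Multiset.mem_add.mp h with h | h
            · rcases Multiset.mem_add.mp h with h | h
              · exact h
              · exact absurd (h2.σ_lt y h) (not_lt.mpr hxy)
            · exact absurd (hyO y h) (lt_irrefl y)
          obtain ⟨rfl, K'', rfl⟩ := eq_cons_of_mem h2.sorted_K hxy hyK hyO hS.pairwise_tail h4
          obtain rfl : o = 0 := by simpa using ho.symm
          rw [completions]
          refine List.mem_flatMap.mpr ⟨_, h1, ?_⟩
          rw [Multiset.cons_add] at hfst'
          rw [← Multiset.cons_coe, Multiset.cons_add, Multiset.cons_add] at h4
          simpa using ih (hpop h2) hS.tail.tail (List.pairwise_cons.mp hS.pairwise_tail).2 rfl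
            ((Multiset.cons_inj_right i).mp hfst') ((Multiset.cons_inj_right y).mp h4)
    · have hcount : O.count i = (letters ((i, b) :: ρ)).count i := by
        have h0 : (S.map Prod.fst : Multiset ℕ).count i = 0 := Multiset.count_eq_zero.mpr hi
        rw [← hfst, Multiset.count_add, h0, zero_add]
      cases b with
      | false =>
        have hiO' : i ∈ O := Multiset.count_pos.mp (by rw [hcount]; simp [letters])
        obtain ⟨O', rfl⟩ := Multiset.exists_cons_of_mem hiO'
        obtain rfl : o = Multiset.card O' + 1 := by simpa using ho.symm
        rw [letters, Multiset.add_cons] at hfst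
        rw [completions]
        refine List.mem_append_left _ (ih (hopen hst' hKi hmi) hS hb rfl
          ((Multiset.cons_inj_right i).mp hfst) ?_)
        rw [← Multiset.cons_coe, Multiset.cons_add, Multiset.cons_add, hsnd, Multiset.add_cons]
      | true =>
        -- Two copies of `i` in the lower row form a weakly increasing pair not below `m`, which
        -- `hb` excludes.
        have h2 : 2 ≤ O.count i := by rw [hcount]; simp [letters]
        have h3 : 2 ≤ (S.map Prod.snd).count i := by
          rw [← Multiset.coe_count, hsnd, Multiset.count_add]
          omega
        obtain ⟨c, d, hs, hc, hd⟩ := exists_sublist_of_two_le_count h3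
        have := List.pairwise_iff_forall_sublist.mp hb hs (by omega)
        omega

theorem mem_initialCompletions {o : ℕ} {σ ρ : List (ℕ × Bool)} {O : Multiset ℕ}
    {S : List (ℕ × ℕ)} (hσ : (σ.map Prod.fst).Pairwise (· > ·))
    (hρ : (ρ.map Prod.fst).Pairwise (· < ·)) (hσρ : ∀ y ∈ letters σ, ∀ j ∈ letters ρ, y < j)
    (hS : IsChainFree S) (ho : Multiset.card O = o)
    (hfst : (S.map Prod.fst : Multiset ℕ) + O = letters ρ)
    (hsnd : (S.map Prod.snd : Multiset ℕ) = letters σ + O) :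
    S ∈ initialCompletions o σ ρ := by
  induction ρ generalizing o σ O with
  | nil =>
    obtain ⟨h1, rfl⟩ : (S.map Prod.fst : Multiset ℕ) = 0 ∧ O = 0 := by
      simpa [letters] using hfst
    obtain rfl : S = [] := by simpa using h1
    have h2 : letters σ = 0 := by simpa using hsnd.symm
    have h3 : σ = [] := by
      match σ, h2 with
      | [], _ => rfl
      | (_, false) :: _, h => simp [letters] at h
      | (_, true) :: _, h => simp [letters] at h
    simp [initialCompletions, h3]
  | cons z ρ ih =>
    obtain ⟨i, b⟩ := z
    have hρi := hρ
    rw [List.map_cons, List.pairwise_cons] at hρ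
    have hiρ : i ∈ letters ((i, b) :: ρ) := by cases b <;> simp [letters]
    have hilt : ∀ j ∈ letters ρ, i < j := fun j hj => hρ.1 j (mem_letters.mp hj)
    have hile : ∀ j ∈ letters ((i, b) :: ρ), i ≤ j := fun j hj => by
      rw [mem_letters, List.map_cons, List.mem_cons] at hj
      rcases hj with rfl | hj
      exacts [le_rfl, (hρ.1 j hj).le]
    have hiO : ∀ j ∈ O, i ≤ j := fun j hj =>
      hile j (hfst ▸ Multiset.mem_add.mpr (.inr hj))
    have hσi : ∀ y ∈ letters σ, y < i := fun y hy => hσρ y hy i hiρ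
    by_cases hi : i ∈ S.map Prod.fst
    · obtain ⟨x, T, rfl⟩ := exists_eq_cons hS hi fun j hj =>
        hile j (hfst ▸ Multiset.mem_add.mpr (.inl hj))
      have hxi : x < i := hS.gt (i, x) List.mem_cons_self
      cases b with
      | false =>
        rw [List.map_cons, ← Multiset.cons_coe] at hfst hsnd
        have hx : x ∈ letters σ := by
          have h : x ∈ letters σ + O := hsnd ▸ Multiset.mem_cons_self _ _
          rcases Multiset.mem_add.mp h with h | h
          · exact h
          · exact absurd (hiO x h) (not_le.mpr hxi)
        rw [letters, Multiset.cons_add] at hfst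
        obtain ⟨K', σ', h1, h2, _, h3⟩ := exists_isState_of_mem_letters (K := []) hS
          List.Pairwise.nil hσ hρ.2 (by simp)
          (fun y hy j hj => (hσi y (by simpa using hy)).trans (hilt j hj)) hx
          (by simpa using hsnd)
        rw [initialCompletions]
        exact List.mem_append_right _ (List.mem_flatMap.mpr ⟨_, h1, List.mem_map.mpr
          ⟨T, mem_completions h2 hS.tail hS.pairwise_tail ho
            ((Multiset.cons_inj_right i).mp hfst) h3, rfl⟩⟩)
      | true =>
        rw [initialCompletions]
        -- No column exists yet, but `i` can play the role of the last minimum: `K` is empty and all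
        -- of `σ` lies below `i`.
        refine List.mem_append_right _ (mem_completions (m := i)
          ⟨List.Pairwise.nil, by simp, hσ, hσi, hρi, hile, by simp⟩ hS ?_ ho hfst
          (by simpa using hsnd))
        exact List.pairwise_cons.mpr ⟨fun _ _ _ => hxi,
          hS.pairwise_tail.imp fun h h' => (h h').trans hxi⟩
    · have h0 : (S.map Prod.fst : Multiset ℕ).count i = 0 := Multiset.count_eq_zero.mpr hi
      have hcount : O.count i = (letters ((i, b) :: ρ)).count i := by
        rw [← hfst, Multiset.count_add, h0, zero_add]
      have hσ' : (((i, b) :: σ).map Prod.fst).Pairwise (· > ·) :=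
        List.pairwise_cons.mpr ⟨fun y hy => hσi y (mem_letters.mpr hy), hσ⟩
      have hσρ' : ∀ y ∈ letters ((i, b) :: σ), ∀ j ∈ letters ρ, y < j := fun y hy j hj => by
        rw [mem_letters, List.map_cons, List.mem_cons] at hy
        rcases hy with rfl | hy
        · exact hilt j hj
        · exact (hσi y (mem_letters.mpr hy)).trans (hilt j hj)
      have hiO' : i ∈ O := Multiset.count_pos.mp (by
        rw [hcount]; exact Multiset.count_pos.mpr hiρ)
      obtain ⟨O', rfl⟩ := Multiset.exists_cons_of_mem hiO'
      cases b with
      | false =>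
        obtain rfl : o = Multiset.card O' + 1 := by simpa using ho.symm
        rw [letters, Multiset.add_cons] at hfst
        rw [initialCompletions, if_pos (by omega)]
        refine List.mem_append_left _ (ih hσ' hρ.2 hσρ' (by simp)
          ((Multiset.cons_inj_right i).mp hfst) ?_)
        rw [letters, Multiset.cons_add, hsnd, Multiset.add_cons]
      | true =>
        have hiO'' : i ∈ O' := Multiset.count_pos.mp (by
          have : 2 ≤ (i ::ₘ O').count i := by rw [hcount]; simp [letters]
          rw [Multiset.count_cons_self] at this
          omega)
        obtain ⟨O'', rfl⟩ := Multiset.exists_cons_of_mem hiO''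
        obtain rfl : o = Multiset.card O'' + 2 := by simpa using ho.symm
        rw [letters, Multiset.add_cons, Multiset.add_cons] at hfst
        rw [initialCompletions, if_pos (by omega)]
        refine List.mem_append_left _ (ih hσ' hρ.2 hσρ' (by simp)
          ((Multiset.cons_inj_right i).mp ((Multiset.cons_inj_right i).mp hfst)) ?_)
        rw [letters, Multiset.cons_add, Multiset.cons_add, hsnd, Multiset.add_cons,
          Multiset.add_cons]

/-! ### The number of normal arrays -/

/-- The letters of a content vector, in increasing order. -/
def codedLetters (n : ℕ →₀ ℕ) : List (ℕ × Bool) :=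
  (n.support.sort (· ≤ ·)).map fun i => (i, n i == 2)

theorem letters_codedLetters {n : ℕ →₀ ℕ} (hn : ∀ i, n i ≤ 2) :
    letters (codedLetters n) = Finsupp.toMultiset n := by
  have key : ∀ l : List ℕ, (∀ i ∈ l, n i ≠ 0) → l.Nodup → ∀ j,
      (letters (l.map fun i => (i, n i == 2))).count j = if j ∈ l then n j else 0 := by
    intro l hl hnd j
    induction l with
    | nil => simp [letters]
    | cons i l ih =>
      have ih := ih (fun i hi => hl i (List.mem_cons_of_mem _ hi)) (List.nodup_cons.mp hnd).2
      have h1 := hl i List.mem_cons_self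
      have h2 := hn i
      have h3 := (List.nodup_cons.mp hnd).1
      rw [List.map_cons]
      obtain h | h : n i = 1 ∨ n i = 2 := by omega
      · by_cases hij : j = i
        · subst hij
          simp [h, letters, ih, h3]
        · simp [h, letters, ih, hij]
      · by_cases hij : j = i
        · subst hij
          simp [h, letters, ih, h3]
        · simp [h, letters, ih, hij]
  ext j
  rw [codedLetters, key _ (by simp) (Finset.sort_nodup _ _), Finsupp.count_toMultiset]
  simp
  tauto

theorem sorted_codedLetters (n : ℕ →₀ ℕ) :
    ((codedLetters n).map Prod.fst).Pairwise (· < ·) := by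
  rw [codedLetters, List.map_map]
  simpa [Function.comp_def] using (Finset.sortedLT_sort n.support).pairwise

theorem countP_codedLetters (n : ℕ →₀ ℕ) (p : ℕ × Bool → Bool) :
    (codedLetters n).countP p = (n.support.filter fun i => p (i, n i == 2)).card := by
  rw [codedLetters, List.countP_map, Finset.card_def, Finset.filter_val,
    ← Multiset.countP_eq_card_filter, ← Finset.sort_eq n.support (· ≤ ·), Multiset.coe_countP]
  congr 1
  ext i
  simp

theorem numSingle_codedLetters {n : ℕ →₀ ℕ} (hn : ∀ i, n i ≤ 2) :
    numSingle (codedLetters n) = (singles n).card := by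
  rw [numSingle, countP_codedLetters, singles]
  congr 1
  refine Finset.filter_congr fun i hi => ?_
  have := Finsupp.mem_support_iff.mp hi
  have := hn i
  simp
  omega

theorem numDouble_codedLetters (n : ℕ →₀ ℕ) :
    numDouble (codedLetters n) = (doubles n).card := by
  rw [numDouble, countP_codedLetters, doubles]
  simp

theorem IsNormal.isChainFree {S : List (ℕ × ℕ)} (h : IsNormal S) : IsChainFree S where
  gt := h.gt
  sorted := h.sorted
  avoids c d e hs hle := by
    obtain ⟨f, hf⟩ := List.sublist_iff_exists_fin_orderEmbedding_get_eq.mp hs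
    refine h.no_increasing ⟨f 0, f 1, f 2, f.strictMono (show (0 : Fin 3) < 1 by decide),
      f.strictMono (show (1 : Fin 3) < 2 by decide), ?_⟩
    rw [← hf 0, ← hf 1, ← hf 2]
    exact hle

theorem toMultiset_content (S : List (ℕ × ℕ)) :
    Finsupp.toMultiset (content S) = (S.map Prod.fst : Multiset ℕ) + (S.map Prod.snd : Multiset ℕ) := by
  ext i
  rw [Finsupp.count_toMultiset, content_eq_count, Multiset.count_add, Multiset.coe_count,
    Multiset.coe_count]

/-- At the start no letter has been reached, so `O` is the entire lower row, of half the degree in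
length. -/
theorem normalArrays_subset {n : ℕ →₀ ℕ} (hn : ∀ i, n i ≤ 2) :
    normalArrays n ⊆ {S | S ∈ initialCompletions (n.degree / 2) [] (codedLetters n)} := by
  rintro S ⟨hS, hc⟩
  refine mem_initialCompletions (O := (S.map Prod.snd : Multiset ℕ)) List.Pairwise.nil
    (sorted_codedLetters n) (by simp [letters]) hS.isChainFree ?_ ?_ (by simp [letters])
  · rw [← hc, degree_content]
    simp
  · rw [letters_codedLetters hn, ← hc, toMultiset_content]

theorem finite_normalArrays {n : ℕ →₀ ℕ} (hn : ∀ i, n i ≤ 2) : (normalArrays n).Finite :=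
  (List.finite_toSet _).subset (normalArrays_subset hn)

theorem ncard_normalArrays_le_length {n : ℕ →₀ ℕ} (hn : ∀ i, n i ≤ 2) :
    (normalArrays n).ncard ≤ (initialCompletions (n.degree / 2) [] (codedLetters n)).length := by
  classical
  have h := Set.ncard_le_ncard (normalArrays_subset hn) (List.finite_toSet _)
  refine h.trans ?_
  rw [← List.coe_toFinset, Set.ncard_coe_finset]
  exact List.toFinset_card_le _

theorem degree_eq {n : ℕ →₀ ℕ} (hn : ∀ i, n i ≤ 2) :
    n.degree = (singles n).card + 2 * (doubles n).card := by
  rw [Finsupp.degree_apply, singles, doubles, Finset.card_filter, Finset.card_filter,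
    Finset.mul_sum, ← Finset.sum_add_distrib]
  refine Finset.sum_congr rfl fun i hi => ?_
  have h1 := Finsupp.mem_support_iff.mp hi
  obtain h | h : n i = 1 ∨ n i = 2 := by have := hn i; omega
  · simp [h]
  · simp [h]

theorem ncard_normalArrays_le {n : ℕ →₀ ℕ} (hn : ∀ i, n i ≤ 2) {s : ℕ} (hs : 0 < s)
    (hl : (singles n).card = 2 * s) : (normalArrays n).ncard ≤ (2 * s - 1).choose s := by
  have h := length_initialCompletions_le hs (codedLetters n) (n.degree / 2) []
    (by rw [numSingle_codedLetters hn, numDouble_codedLetters, degree_eq hn]; simp; omega)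
    (by rw [numSingle_codedLetters hn, hl]; simp)
  rw [intChoose_natCast, intChoose_neg _ (by rw [degree_eq hn]; omega), sub_zero] at h
  exact (ncard_normalArrays_le_length hn).trans (by exact_mod_cast h)

theorem ncard_normalArrays_le_of_singles_eq_zero {n : ℕ →₀ ℕ} (hn : ∀ i, n i ≤ 2)
    (hl : (singles n).card = 0) :
    (normalArrays n).ncard ≤ if Even (doubles n).card then 1 else 0 := by
  have h := length_initialCompletions_le_of_numSingle_eq_zero (codedLetters n) (n.degree / 2) []
    (by rw [numDouble_codedLetters, degree_eq hn]; simp; omega) rfl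
    (by rw [numSingle_codedLetters hn, hl])
  have hd : n.degree / 2 = (doubles n).card := by rw [degree_eq hn]; omega
  rw [hd] at h
  refine (ncard_normalArrays_le_length hn).trans ?_
  rwa [hd]

end WeakPI

/-! ### From proper polynomials to skew pairings, and the comparison of the bounds. -/

namespace WeakPI

/-! ### Evaluation of proper polynomials -/

section Evaluation

variable {F : Type*} [Field F]

/-- Evaluation of polynomials on elements of `M_{1,1}(E)`, with values in matrices over `E`. -/
noncomputable def evalMatrix (w : ℕ → M11 F) :
    FreeAlgebra F ℕ →ₐ[F] Matrix (Fin 2) (Fin 2) (Grassmann F) :=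
  (M11 F).val.comp (FreeAlgebra.lift F w)

theorem evalMatrix_ι (w : ℕ → M11 F) (i : ℕ) : evalMatrix w (FreeAlgebra.ι F i) = (w i).1 := by
  simp [evalMatrix]

theorem evalMatrix_eq_zero_iff (w : ℕ → M11 F) (f : FreeAlgebra F ℕ) :
    evalMatrix w f = 0 ↔ FreeAlgebra.lift F w f = 0 := by
  rw [evalMatrix, AlgHom.comp_apply]
  exact ⟨fun h => Subtype.ext h, fun h => by rw [h, map_zero]⟩

/-- Equal even diagonal entries are central and drop out of the commutator. The products of the
off-diagonal parts are diagonal, and anticommutation of odd elements makes the two diagonal entries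
equal. -/
theorem evalMatrix_lie {w : ℕ → M11 F} (hw : ∀ i, w i ∈ supertraceZero F) (i j : ℕ) :
    evalMatrix w ⁅FreeAlgebra.ι F i, FreeAlgebra.ι F j⁆ = Matrix.scalar (Fin 2)
      ((w i).1 0 1 * (w j).1 1 0 - (w j).1 0 1 * (w i).1 1 0) := by
  have hs : ∀ k, (w k).1 1 1 = (w k).1 0 0 := fun k =>
    (sub_eq_zero.mp (LinearMap.mem_ker.mp (hw k))).symm
  have ha : ∀ k x, (w k).1 0 0 * x = x * (w k).1 0 0 := fun k x =>
    (commute_of_mem_even (w k).2.1 x).eq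
  have hbc : ∀ k l, (w k).1 1 0 * (w l).1 0 1 = -((w l).1 0 1 * (w k).1 1 0) := fun k l =>
    mul_eq_neg_mul_of_mem_odd (w k).2.2.2.2 (w l).2.2.2.1
  rw [Ring.lie_def, map_sub, map_mul, map_mul, evalMatrix_ι, evalMatrix_ι]
  ext p q
  fin_cases p <;> fin_cases q
  · simp [Matrix.mul_apply, Fin.sum_univ_two, ha i ((w j).1 0 0)]
  · simp [Matrix.mul_apply, Fin.sum_univ_two, hs, ha i ((w j).1 0 1), ha j ((w i).1 0 1)]
    abel
  · simp [Matrix.mul_apply, Fin.sum_univ_two, hs, ha i ((w j).1 1 0), ha j ((w i).1 1 0)]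
    abel
  · simp [Matrix.mul_apply, Fin.sum_univ_two, hs, ha i ((w j).1 0 0), hbc]
    abel

/-- The innermost commutator is already an even scalar matrix, hence central. -/
theorem evalMatrix_commutator_cons {w : ℕ → M11 F} (hw : ∀ i, w i ∈ supertraceZero F)
    (i j k : ℕ) (l : List ℕ) : evalMatrix w (commutator F i j (k :: l)) = 0 := by
  have h0 : ∀ (l : List ℕ) (u : FreeAlgebra F ℕ), evalMatrix w u = 0 →
      evalMatrix w (l.foldl (fun u a => ⁅u, FreeAlgebra.ι F a⁆) u) = 0 := by
    intro l
    induction l with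
    | nil => exact fun u hu => hu
    | cons a l ih => exact fun u hu => ih _ (by simp [Ring.lie_def, hu])
  rw [commutator, List.foldl_cons]
  refine h0 l _ ?_
  rw [Ring.lie_def, map_sub, map_mul, map_mul, evalMatrix_lie hw, sub_eq_zero]
  refine Matrix.scalar_commute _ (fun x => commute_of_mem_even ?_ x) _
  have h11 : (1 : ZMod 2) + 1 = 0 := by decide
  refine sub_mem ?_ ?_
  · simpa only [h11] using grassmannPart_mul_mem (w i).2.2.2.1 (w j).2.2.2.2
  · simpa only [h11] using grassmannPart_mul_mem (w j).2.2.2.1 (w i).2.2.2.2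

variable (F) in
/-- The generic matrices of supertrace zero with zero diagonal. -/
noncomputable def genericMatrix (i : ℕ) : M11 F :=
  ⟨!![0, upper F i; lower F i, 0], by
    refine ⟨?_, ?_, ?_, ?_⟩
    · simp
    · simp
    · simpa using upper_mem i
    · simpa using lower_mem i⟩

theorem genericMatrix_mem (i : ℕ) : genericMatrix F i ∈ supertraceZero F := by
  rw [supertraceZero, LinearMap.mem_ker]
  simp [str, genericMatrix]

theorem evalMatrix_generic_lie (i j : ℕ) :
    evalMatrix (genericMatrix F) ⁅FreeAlgebra.ι F i, FreeAlgebra.ι F j⁆ =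
      Matrix.scalar (Fin 2) (skew (genericPairing F) i j).1 := by
  rw [evalMatrix_lie genericMatrix_mem]
  simp [genericMatrix, skew, genericPairing]
  rfl

theorem evalMatrix_generic_arrayPolynomial (S : List (ℕ × ℕ)) :
    evalMatrix (genericMatrix F) (arrayPolynomial F S) =
      Matrix.scalar (Fin 2) (skewProd (genericPairing F) S).1 := by
  induction S with
  | nil => simp [arrayPolynomial, skewProd]
  | cons c S ih =>
    rw [arrayPolynomial, List.map_cons, List.prod_cons, map_mul, evalMatrix_generic_lie]
    rw [arrayPolynomial] at ih
    rw [ih, ← map_mul, skewProd_cons]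
    rfl

/-- On proper polynomials, every evaluation factors through the generic one. -/
theorem evalMatrix_eq_of_mem_properPolynomials (hF : ringChar F ≠ 2) {w : ℕ → M11 F}
    (hw : ∀ i, w i ∈ supertraceZero F) : ∃ ψ : Grassmann F →ₐ[F] Grassmann F,
      ∀ f ∈ properPolynomials F,
        evalMatrix w f = ψ.mapMatrix (evalMatrix (genericMatrix F) f) := by
  obtain ⟨ψ, hψ⟩ := exists_algHom_of_odd hF (fun i => (w i).1 0 1) (fun i => (w i).1 1 0)
    (fun i => (w i).2.2.2.1) (fun i => (w i).2.2.2.2)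
  have hu : ∀ i, ψ (upper F i) = (w i).1 0 1 := fun i => (hψ i).1
  have hl : ∀ i, ψ (lower F i) = (w i).1 1 0 := fun i => (hψ i).2
  refine ⟨ψ, fun f hf => ?_⟩
  have hle : properPolynomials F ≤ AlgHom.equalizer (evalMatrix w)
      (ψ.mapMatrix.comp (evalMatrix (genericMatrix F))) := by
    refine Algebra.adjoin_le ?_
    rintro _ ⟨i, j, l, rfl⟩
    change evalMatrix w _ = ψ.mapMatrix (evalMatrix (genericMatrix F) _)
    cases l with
    | nil =>
      rw [commutator, List.foldl_nil, evalMatrix_lie hw, evalMatrix_lie genericMatrix_mem]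
      ext p q
      fin_cases p <;> fin_cases q <;> simp [genericMatrix, hu, hl]
    | cons k l =>
      rw [evalMatrix_commutator_cons hw, evalMatrix_commutator_cons genericMatrix_mem, map_zero]
  exact hle hf

theorem exists_scalar_of_mem_properPolynomials {f : FreeAlgebra F ℕ}
    (hf : f ∈ properPolynomials F) :
    ∃ z, evalMatrix (genericMatrix F) f = Matrix.scalar (Fin 2) z := by
  induction hf using Algebra.adjoin_induction with
  | mem f hf =>
    obtain ⟨i, j, l, rfl⟩ := hf
    cases l with
    | nil => exact ⟨_, evalMatrix_generic_lie i j⟩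
    | cons k l => exact ⟨0, by rw [evalMatrix_commutator_cons genericMatrix_mem, map_zero]⟩
  | algebraMap r =>
    refine ⟨algebraMap F _ r, ?_⟩
    rw [AlgHom.commutes]
    rfl
  | add f g _ _ hf hg =>
    obtain ⟨y, hy⟩ := hf
    obtain ⟨z, hz⟩ := hg
    exact ⟨y + z, by rw [map_add, hy, hz, map_add]⟩
  | mul f g _ _ hf hg =>
    obtain ⟨y, hy⟩ := hf
    obtain ⟨z, hz⟩ := hg
    exact ⟨y * z, by rw [map_mul, hy, hz, map_mul]⟩

variable (F) in
/-- The upper left entry of the generic evaluation. -/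
noncomputable def genericEval : FreeAlgebra F ℕ →ₗ[F] Grassmann F :=
  Matrix.entryLinearMap F (Grassmann F) (0 : Fin 2) (0 : Fin 2) ∘ₗ
    (evalMatrix (genericMatrix F)).toLinearMap

theorem genericEval_apply (f : FreeAlgebra F ℕ) :
    genericEval F f = evalMatrix (genericMatrix F) f 0 0 := rfl

theorem genericEval_arrayPolynomial (S : List (ℕ × ℕ)) :
    genericEval F (arrayPolynomial F S) = (skewProd (genericPairing F) S).1 := by
  rw [genericEval_apply, evalMatrix_generic_arrayPolynomial]
  simp

/-- Every evaluation of a proper polynomial is the image of the generic one, which is a scalar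
matrix and so is determined by one diagonal entry. -/
theorem mem_Iw_iff (hF : ringChar F ≠ 2) {f : FreeAlgebra F ℕ} (hf : f ∈ properPolynomials F) :
    f ∈ Iw F ↔ genericEval F f = 0 := by
  constructor
  · intro h
    have := (evalMatrix_eq_zero_iff _ _).mpr (h (genericMatrix F) genericMatrix_mem)
    rw [genericEval_apply, this, Matrix.zero_apply]
  · intro h w hw
    obtain ⟨ψ, hψ⟩ := evalMatrix_eq_of_mem_properPolynomials hF hw
    obtain ⟨z, hz⟩ := exists_scalar_of_mem_properPolynomials hf
    rw [genericEval_apply, hz] at h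
    have hz0 : z = 0 := by simpa using h
    rw [← evalMatrix_eq_zero_iff, hψ f hf, hz, hz0, map_zero, map_zero]

variable (F) in
/-- The projection onto a multihomogeneous component of the free algebra. -/
noncomputable def homogeneousProj (n : ℕ →₀ ℕ) : FreeAlgebra F ℕ →ₗ[F] FreeAlgebra F ℕ :=
  open Classical in
  (FreeAlgebra.basisFreeMonoid F ℕ).constr F fun w =>
    if wordContent w.toList = n then FreeAlgebra.basisFreeMonoid F ℕ w else 0

theorem basisFreeMonoid_apply (w : FreeMonoid ℕ) :
    FreeAlgebra.basisFreeMonoid F ℕ w = (w.toList.map (FreeAlgebra.ι F)).prod := by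
  simp [FreeAlgebra.basisFreeMonoid, FreeAlgebra.equivMonoidAlgebraFreeMonoid, FreeMonoid.lift_apply]

theorem homogeneousProj_of_mem {m n : ℕ →₀ ℕ} {f : FreeAlgebra F ℕ}
    (hf : f ∈ multihomogeneous F m) :
    homogeneousProj F n f = open Classical in if m = n then f else 0 := by
  classical
  induction hf using Submodule.span_induction with
  | mem f hf =>
    obtain ⟨w, rfl, rfl⟩ := hf
    have := basisFreeMonoid_apply (F := F) (FreeMonoid.ofList w)
    rw [FreeMonoid.toList_ofList] at this
    rw [← this, homogeneousProj, Module.Basis.constr_basis, FreeMonoid.toList_ofList]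
  | zero => simp
  | add f g _ _ hf hg => rw [map_add, hf, hg]; split_ifs <;> simp
  | smul r f _ hf => rw [map_smul, hf]; split_ifs <;> simp

theorem commutator_mem_multihomogeneous (i j : ℕ) (l : List ℕ) :
    ∃ m, commutator F i j l ∈ multihomogeneous F m := by
  have h0 : ∀ (l : List ℕ) (u : FreeAlgebra F ℕ) (m : ℕ →₀ ℕ), u ∈ multihomogeneous F m →
      ∃ m', l.foldl (fun u a => ⁅u, FreeAlgebra.ι F a⁆) u ∈ multihomogeneous F m' := by
    intro l
    induction l with
    | nil => exact fun u m hu => ⟨m, hu⟩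
    | cons a l ih =>
      intro u m hu
      have ha : FreeAlgebra.ι F a ∈ multihomogeneous F (wordContent [a]) :=
        Submodule.subset_span ⟨[a], rfl, by simp⟩
      refine ih _ (m + wordContent [a]) ?_
      change ⁅u, FreeAlgebra.ι F a⁆ ∈ _
      rw [Ring.lie_def]
      refine sub_mem (multihomogeneous_mul_mem hu ha) ?_
      rw [add_comm]
      exact multihomogeneous_mul_mem ha hu
  have h1 : ⁅FreeAlgebra.ι F i, FreeAlgebra.ι F j⁆ = arrayPolynomial F [(i, j)] := by
    simp [arrayPolynomial]
  exact h0 l _ _ (h1 ▸ arrayPolynomial_mem_multihomogeneous [(i, j)])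

/-- An element of `B^{(n_i)}` is only known to be a combination of commutator products of arbitrary
multidegrees. The projection discards those of other degrees; a product that remains evaluates to
zero or to a skew product of content `n`. -/
theorem genericEval_homogeneousProj_mem {f : FreeAlgebra F ℕ} (hf : f ∈ properPolynomials F)
    (n : ℕ →₀ ℕ) : genericEval F (homogeneousProj F n f) ∈
      (skewSpan F (genericPairing F) n).map (Subalgebra.center F (Grassmann F)).val.toLinearMap := by
  rw [properPolynomials, ← Subalgebra.mem_toSubmodule, Algebra.adjoin_eq_span] at hf
  induction hf using Submodule.span_induction with
  | zero => rw [map_zero, map_zero]; exact zero_mem _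
  | add f g _ _ hf hg => rw [map_add, map_add]; exact add_mem hf hg
  | smul r f _ hf => rw [map_smul, map_smul]; exact Submodule.smul_mem _ r hf
  | mem f hf =>
    have key : ∃ m, f ∈ multihomogeneous F m ∧ (evalMatrix (genericMatrix F) f = 0 ∨
        ∃ S, content S = m ∧ evalMatrix (genericMatrix F) f =
          evalMatrix (genericMatrix F) (arrayPolynomial F S)) := by
      induction hf using Submonoid.closure_induction with
      | mem f hf =>
        obtain ⟨i, j, l, rfl⟩ := hf
        cases l with
        | nil =>
          have h : commutator F i j [] = arrayPolynomial F [(i, j)] := by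
            simp [commutator, arrayPolynomial]
          rw [h]
          exact ⟨_, arrayPolynomial_mem_multihomogeneous _, .inr ⟨_, rfl, rfl⟩⟩
        | cons k l =>
          obtain ⟨m, hm⟩ := commutator_mem_multihomogeneous (F := F) i j (k :: l)
          exact ⟨m, hm, .inl (evalMatrix_commutator_cons genericMatrix_mem i j k l)⟩
      | one =>
        have h : (1 : FreeAlgebra F ℕ) = arrayPolynomial F [] := by simp [arrayPolynomial]
        rw [h]
        exact ⟨_, arrayPolynomial_mem_multihomogeneous _, .inr ⟨_, rfl, rfl⟩⟩
      | mul f g _ _ hf hg =>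
        obtain ⟨m, hm, hf⟩ := hf
        obtain ⟨m', hm', hg⟩ := hg
        refine ⟨m + m', multihomogeneous_mul_mem hm hm', ?_⟩
        rcases hf with hf | ⟨S, rfl, hS⟩
        · exact .inl (by rw [map_mul, hf, zero_mul])
        rcases hg with hg | ⟨T, rfl, hT⟩
        · exact .inl (by rw [map_mul, hg, mul_zero])
        refine .inr ⟨S ++ T, content_append S T, ?_⟩
        rw [map_mul, hS, hT, ← map_mul, arrayPolynomial, arrayPolynomial, arrayPolynomial,
          List.map_append, List.prod_append]
    obtain ⟨m, hm, hf⟩ := key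
    rw [homogeneousProj_of_mem hm]
    split_ifs with hmn
    · subst hmn
      rcases hf with hf | ⟨S, rfl, hS⟩
      · rw [genericEval_apply, hf]
        exact zero_mem _
      · rw [genericEval_apply, hS, ← genericEval_apply, genericEval_arrayPolynomial]
        exact Submodule.mem_map_of_mem (skewProd_mem_skewSpan S)
    · rw [map_zero]
      exact zero_mem _

end Evaluation

/-! ### The components -/

section Components

variable {F : Type*} [Field F]

/-- The component `B^{(n_i)}(I_w)` is embedded into the Grassmann algebra by the generic
evaluation, with the span of the products of skew pairings as its image. -/
theorem exists_embedding (hF : ringChar F ≠ 2) (n : ℕ →₀ ℕ) :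
    ∃ κ : QuotComponent F n →ₗ[F] Grassmann F, Function.Injective κ ∧
      LinearMap.range κ = (skewSpan F (genericPairing F) n).map
        (Subalgebra.center F (Grassmann F)).val.toLinearMap ∧
      ∀ S : normalArrays n, κ (arrayClass F n S) = (skewProd (genericPairing F) S.1).1 := by
  let Φ : properComponent F n →ₗ[F] Grassmann F := genericEval F ∘ₗ (properComponent F n).subtype
  have hker : LinearMap.ker Φ = (Iw F).submoduleOf (properComponent F n) := by
    ext f
    rw [LinearMap.mem_ker, Submodule.submoduleOf, Submodule.mem_comap]
    exact (mem_Iw_iff hF f.2.1).symm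
  refine ⟨Submodule.liftQ _ Φ hker.ge, ?_, ?_, fun S => ?_⟩
  · rw [← LinearMap.ker_eq_bot]
    exact Submodule.ker_liftQ_eq_bot _ _ _ hker.le
  · rw [Submodule.range_liftQ]
    apply le_antisymm
    · rintro _ ⟨f, rfl⟩
      have := genericEval_homogeneousProj_mem f.2.1 n
      rwa [homogeneousProj_of_mem f.2.2, if_pos rfl] at this
    · rw [skewSpan, Submodule.map_span, Submodule.span_le]
      rintro _ ⟨_, ⟨S, rfl, rfl⟩, rfl⟩
      exact ⟨⟨arrayPolynomial F S, arrayPolynomial_mem S⟩, genericEval_arrayPolynomial S⟩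
  · exact genericEval_arrayPolynomial S.1

theorem skewSpan_eq_span_normalArrays (hF : ringChar F ≠ 2) {n : ℕ →₀ ℕ} (hn : ∀ i, n i ≤ 2) :
    skewSpan F (genericPairing F) n
      = Submodule.span F (skewProd (genericPairing F) '' normalArrays n) := by
  apply le_antisymm
  · rw [skewSpan, Submodule.span_le]
    rintro _ ⟨S, hS, rfl⟩
    exact skewProd_mem_span_normalArrays hF (genericPairing_exchange F) hn S hS
  · refine Submodule.span_mono ?_
    rintro _ ⟨S, hS, rfl⟩
    exact ⟨S, hS.2, rfl⟩

theorem subsingleton_of_isExceptional (hF : ringChar F ≠ 2) {n : ℕ →₀ ℕ} (h : IsExceptional n) :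
    Subsingleton (QuotComponent F n) := by
  obtain ⟨κ, hκ, hr, _⟩ := exists_embedding hF n
  have hbot : skewSpan F (genericPairing F) n = ⊥ := by
    rcases h with h | ⟨_, i, hi⟩ | ⟨_, hn, h1, h2⟩
    · rw [skewSpan, Submodule.span_eq_bot]
      rintro _ ⟨S, rfl, rfl⟩
      rw [degree_content] at h
      exact absurd (even_two_mul _) (Nat.not_even_iff_odd.mpr h)
    · rw [skewSpan, Submodule.span_eq_bot]
      rintro _ ⟨S, rfl, rfl⟩
      exact skewProd_eq_zero_of_two_lt hF (genericPairing_exchange F) S hi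
    -- The count shows that there are no normal arrays here, and they span.
    · have hN := ncard_normalArrays_le_of_singles_eq_zero hn h1
      rw [if_neg (show ¬ Even (doubles n).card from Nat.not_even_iff_odd.mpr h2), Nat.le_zero,
        Set.ncard_eq_zero (finite_normalArrays hn)] at hN
      rw [skewSpan_eq_span_normalArrays hF hn, hN, Set.image_empty, Submodule.span_empty]
  refine ⟨fun x y => hκ ?_⟩
  have hz : ∀ x, κ x = 0 := fun x => by
    have : κ x ∈ LinearMap.range κ := ⟨x, rfl⟩
    rw [hr, hbot, Submodule.map_bot] at this
    exact this
  rw [hz, hz]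

/-- The dimension is at most the number of normal arrays, which is at most the binomial, which is at
most the dimension. Equality throughout makes the spanning family independent. -/
theorem basis_of_not_isExceptional (hF : ringChar F ≠ 2) {n : ℕ →₀ ℕ} (h : ¬ IsExceptional n) :
    LinearIndependent F (arrayClass F n) ∧ Submodule.span F (Set.range (arrayClass F n)) = ⊤ ∧
      ∃ s : ℕ, occurrences n 1 = 2 * s ∧ Module.Finite F (QuotComponent F n) ∧
        Module.finrank F (QuotComponent F n) = (2 * s - 1).choose s := by
  have heven : Even n.degree := by
    by_contra h'
    exact h (.inl (Nat.not_even_iff_odd.mp h'))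
  have hn : ∀ i, n i ≤ 2 := by
    by_contra! h'
    exact h (.inr (.inl ⟨heven, h'⟩))
  obtain ⟨s, hs⟩ : ∃ s, (singles n).card = 2 * s := by
    rw [degree_eq hn, Nat.even_add] at heven
    obtain ⟨s, hs⟩ := heven.mpr (even_two_mul _)
    exact ⟨s, by omega⟩
  have hD : s = 0 → Even (doubles n).card := fun h0 => by
    by_contra h'
    exact h (.inr (.inr ⟨heven, hn, by rw [h0] at hs; exact hs, Nat.not_even_iff_odd.mp h'⟩))
  have hN : (normalArrays n).ncard ≤ (2 * s - 1).choose s := by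
    rcases Nat.eq_zero_or_pos s with rfl | hs0
    · have := ncard_normalArrays_le_of_singles_eq_zero hn hs
      rw [if_pos (hD rfl)] at this
      simpa using this
    · exact ncard_normalArrays_le hn hs0 hs
  obtain ⟨κ, hκ, hr, hS⟩ := exists_embedding hF n
  have hspan : Submodule.span F (Set.range (arrayClass F n)) = ⊤ := by
    apply Submodule.map_injective_of_injective hκ
    rw [Submodule.map_top, hr, Submodule.map_span, skewSpan_eq_span_normalArrays hF hn,
      Submodule.map_span]
    congr 1
    ext x
    constructor
    · rintro ⟨_, ⟨S, rfl⟩, rfl⟩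
      exact ⟨_, ⟨S.1, S.2, rfl⟩, (hS S).symm⟩
    · rintro ⟨_, ⟨S, hSn, rfl⟩, rfl⟩
      exact ⟨_, ⟨⟨S, hSn⟩, rfl⟩, hS ⟨S, hSn⟩⟩
  have := (finite_normalArrays hn).fintype
  have hfin : Module.Finite F (QuotComponent F n) :=
    ⟨hspan ▸ Submodule.fg_span (Set.finite_range _)⟩
  have hcard : Fintype.card (normalArrays n) = (normalArrays n).ncard := by
    rw [← Nat.card_eq_fintype_card, Nat.card_coe_set_eq]
  have hle : Module.finrank F (QuotComponent F n) ≤ Fintype.card (normalArrays n) := by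
    have := finrank_range_le_card (R := F) (arrayClass F n)
    rwa [Set.finrank, hspan, finrank_top] at this
  obtain ⟨ι, _, q, hq, hli, hmem⟩ := exists_linearIndependent_skewSpan hF hn hs hD
  have hex : ∀ b, ∃ x, κ x = (q b : Grassmann F) := fun b => by
    have : (q b : Grassmann F) ∈ LinearMap.range κ := by
      rw [hr]
      exact Submodule.mem_map_of_mem (hmem b)
    exact this
  choose r hr' using hex
  have hlr : LinearIndependent F r := by
    refine LinearIndependent.of_comp κ ?_
    have : κ ∘ r = (Subalgebra.center F (Grassmann F)).val.toLinearMap ∘ q := funext hr'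
    rw [this]
    exact hli.map' _ (LinearMap.ker_eq_bot.mpr Subtype.val_injective)
  have hge := hlr.fintype_card_le_finrank
  rw [hq] at hge
  refine ⟨linearIndependent_of_top_le_span_of_card_eq_finrank hspan.ge (by omega), hspan, s, hs,
    hfin, by omega⟩

end Components

end WeakPI

theorem theorem7p1 {F : Type*} [Field F] [Infinite F] (hF : ringChar F ≠ 2) (n : ℕ →₀ ℕ) :
    (Subsingleton (WeakPI.QuotComponent F n) ↔ WeakPI.IsExceptional n) ∧
    (¬ WeakPI.IsExceptional n →
      LinearIndependent F (WeakPI.arrayClass F n) ∧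
      Submodule.span F (Set.range (WeakPI.arrayClass F n)) = ⊤ ∧
      ∃ s : ℕ, WeakPI.occurrences n 1 = 2 * s ∧
        Module.Finite F (WeakPI.QuotComponent F n) ∧
        -- for `s = 0` the truncated subtraction gives the convention `binom(-1, 0) = 1`
        Module.finrank F (WeakPI.QuotComponent F n) = (2 * s - 1).choose s) := by
  refine ⟨⟨fun h => ?_, WeakPI.subsingleton_of_isExceptional hF⟩,
    WeakPI.basis_of_not_isExceptional hF⟩
  by_contra hn
  obtain ⟨_, _, s, _, _, hs⟩ := WeakPI.basis_of_not_isExceptional hF hn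
  rw [Module.finrank_zero_of_subsingleton] at hs
  -- The binomial is positive; for `s = 0` truncation turns `2 * s - 1` into `0`.
  exact (Nat.choose_pos (by omega : s ≤ 2 * s - 1)).ne hs
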